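/- Let $\Omega=\{x\in\mathbb R^3: |x|>1\}$, and let $\dot H^1_0(\Omega)$ denote the space of radial functions $f(x)=g(|x|)$ on $\Omega$ with values in $\mathbb C$, where $g$ is absolutely continuous on $[1,R]$ for every $R>1$, $g(1)=0$, $\nabla f\in L^2(\Omega)$ and $f\in L^6(\Omega)$, with norm $\|\nabla f\|_{L^2(\Omega)}$. Put $$E(f)=\tfrac12\int_\Omega|\nabla f|^2\,dx+\tfrac16\int_\Omega|f|^6\,dx,\qquad F(f)=|f|^4f .$$ The free propagator $e^{it\Delta_D}$ (with $\Delta_D$ the Dirichlet Laplacian) is defined on $\dot H^1_0(\Omega)$ by $e^{it\Delta_D}f=\mathcal F_0^*\bigl(e^{-i\lambda^2t}\,\mathcal F_0f\bigr)$, where $$(\mathcal F_0^*g)(x)=\sqrt{\tfrac2\pi}\int_0^\infty\frac{\sin\lambda(|x|-1)}{|x|}\,g(\lambda)\,d\lambda$$ is the isomorphism of $L^2((0,\infty),\lambda^2d\lambda)$ onto $\dot H^1_0(\Omega)$ and $\mathcal F_0$ is its inverse. A (strong) solution of the defocusing equation $i\partial_tu+\Delta u=|u|^4u$, $u|_{\partial\Omega}=0$,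 on a time interval $T$ is a function $u\in C^0_t\dot H^1_0(T\times\Omega)$ with $$u(t_1)=e^{i(t_1-t_0)\Delta_D}u(t_0)-i\int_{t_0}^{t_1}e^{i(t_1-t)\Delta_D}F(u(t))\,dt\qquad\text{for all }t_0,t_1\in T .$$ Let $u$ be a solution on $[t_-,t_+]$, let $u_\pm(t)=e^{i(t-t_\pm)\Delta_D}u(t_\pm)$, and let $\eta_0>0$. Call a subinterval $I=[a,b]\subset[t_-,t_+]$ with $$\eta_0<\|u\|_{L^{10}_{t,x}(I\times\Omega)}\le2\eta_0$$ unexceptional if $\|u_+\|_{L^{10}_{t,x}(I\times\Omega)}\le\eta_0^{10}$ and $\|u_-\|_{L^{10}_{t,x}(I\times\Omega)}\le\eta_0^{10}$. **Lemma 3.4.** For every $E$ and every $\eta_0>0$ there is a constant $\eta_1>0$, depending only on $\eta_0$ and $E$, such that for every compact interval $[t_-,t_+]$, every solution $u$ on $[t_-,t_+]$ with $E(u(t_0))\le E$ for some $t_0\in[t_-,t_+]$, and every unexceptional interval $I\subset[t_-,t_+]$ (in particular every unexceptional interval of a decomposition of $[t_-,t_+]$ into intervals $I_j$ with $\eta_0<\|u\|_{L^{10}_{t,x}(I_j\times\Omega)}\le2\eta_0$),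 one has $$|I|>\eta_1 .$$ -/

import Mathlib

open MeasureTheory Set Filter Topology

namespace ExteriorNLS

noncomputable section

/-- Three-dimensional Euclidean space. -/
abbrev E3 : Type := EuclideanSpace ℝ (Fin 3)

/-- The exterior domain `Ω = ℝ³ \ closed unit ball`. -/
def Omega : Set E3 := {x | 1 < ‖x‖}

/-- Lebesgue measure on `Ω`. -/
def volOmega : Measure E3 := (volume : Measure E3).restrict Omega

/-- The (complex) gradient of a function on `ℝ³`; its Euclidean norm is `|∇f(x)|`. For the radial
functions below, whose profile is locally absolutely continuous, it exists almost everywhere on the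
open set `Ω` and is the weak gradient there. -/
def grad (f : E3 → ℂ) (x : E3) : EuclideanSpace ℂ (Fin 3) :=
  WithLp.toLp 2 (fun i => fderiv ℝ f x (EuclideanSpace.single i (1 : ℝ)))

/-- Radial `Ḣ¹₀(Ω)`: functions `f(x) = g(|x|)` on `Ω` with `g` absolutely continuous on each
`[1, R]`, `g(1) = 0`, `∇f ∈ L²(Ω)` and `f ∈ L⁶(Ω)`. Only the values on `Ω` matter. -/
def MemH10 (f : E3 → ℂ) : Prop :=
  (∃ g : ℝ → ℂ, (∀ x ∈ Omega, f x = g ‖x‖) ∧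
      (∀ R : ℝ, 1 < R → AbsolutelyContinuousOnInterval g 1 R) ∧ g 1 = 0) ∧
    MemLp (grad f) 2 volOmega ∧ MemLp f 6 volOmega

/-- The norm `‖f‖_{Ḣ¹₀(Ω)} = ‖∇f‖_{L²(Ω)}`. -/
def normH10 (f : E3 → ℂ) : ENNReal := eLpNorm (grad f) 2 volOmega

/-- The energy `E(f) = ½ ∫_Ω |∇f|² dx + ⅙ ∫_Ω |f|⁶ dx`. -/
def energy (f : E3 → ℂ) : ℝ :=
  (1 / 2) * (∫ x in Omega, ‖grad f x‖ ^ 2) + (1 / 6) * (∫ x in Omega, ‖f x‖ ^ 6)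

/-- The inverse distorted Fourier transform for radial functions on `Ω`,
`(𝓕₀* g)(x) = √(2/π) ∫₀^∞ sin(λ(r-1))/r · g(λ) dλ` with `r = |x|`. The integral converges absolutely
when `λ g(λ)` lies in `L²(0,∞)`. -/
def sineInv (g : ℝ → ℂ) (x : E3) : ℂ :=
  (Real.sqrt (2 / Real.pi) : ℂ) *
    ∫ l in Ioi (0 : ℝ), ((Real.sin (l * (‖x‖ - 1)) / ‖x‖ : ℝ) : ℂ) * g l

/-- `g` is a distorted Fourier transform of `f`: it lies in `L²((0,∞), λ² dλ)` and `𝓕₀* g = f` on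
`Ω`. -/
def IsSineTransform (f : E3 → ℂ) (g : ℝ → ℂ) : Prop :=
  MemLp (fun l : ℝ => (l : ℂ) * g l) 2 (volume.restrict (Ioi (0 : ℝ))) ∧
    ∀ x ∈ Omega, f x = sineInv g x

open Classical in
/-- The distorted Fourier transform `𝓕₀`, as the inverse of the isomorphism `𝓕₀*` from
`L²((0,∞), λ² dλ)` onto radial `Ḣ¹₀(Ω)`. It is determined up to a null set. -/
def sineTransform (f : E3 → ℂ) : ℝ → ℂ :=
  if h : ∃ g : ℝ → ℂ, IsSineTransform f g then h.choose else 0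

/-- The free Schrödinger propagator `e^{itΔ_D} f = 𝓕₀*(e^{-iλ²t} 𝓕₀ f)` on radial `Ḣ¹₀(Ω)`. -/
def freeProp (t : ℝ) (f : E3 → ℂ) : E3 → ℂ :=
  sineInv (fun l => Complex.exp (-Complex.I * (l : ℂ) ^ 2 * (t : ℂ)) * sineTransform f l)

/-- The nonlinearity `F(u) = |u|⁴ u`. -/
def nonlin (f : E3 → ℂ) (x : E3) : ℂ := ((‖f x‖ ^ 4 : ℝ) : ℂ) * f x

/-- Strong radial `Ḣ¹₀(Ω)` solutions of `i∂ₜu + Δu = |u|⁴u`, `u = 0` on `∂Ω`, on the time interval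
`I`: `u ∈ C⁰ₜ Ḣ¹₀(I × Ω)` and the Duhamel formula holds for all times in `I`. Point evaluations on
`Ω` are continuous on radial `Ḣ¹₀(Ω)`, so the time integral may be taken pointwise in `x`. -/
structure IsStrongSolution (I : Set ℝ) (u : ℝ → E3 → ℂ) : Prop where
  mem : ∀ t ∈ I, MemH10 (u t)
  cont : ∀ t₀ ∈ I, Tendsto (fun t => normH10 (fun x => u t x - u t₀ x)) (𝓝[I] t₀) (𝓝 0)
  duhamel : ∀ t₀ ∈ I, ∀ t₁ ∈ I, ∀ x ∈ Omega,
    u t₁ x = freeProp (t₁ - t₀) (u t₀) x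
      - Complex.I * ∫ t in t₀..t₁, freeProp (t₁ - t) (nonlin (u t)) x

/-- The norm `‖u‖_{L¹⁰_{t,x}(I × Ω)}`. -/
def normL10 (I : Set ℝ) (u : ℝ → E3 → ℂ) : ENNReal :=
  eLpNorm (fun p : ℝ × E3 => u p.1 p.2) 10 (((volume : Measure ℝ).restrict I).prod volOmega)

/-- `u` carries `L¹⁰_{t,x}` norm about `η₀` on `I`: `η₀ < ‖u‖_{L¹⁰_{t,x}(I × Ω)} ≤ 2η₀`. -/
def CarriesNorm (η₀ : ℝ) (I : Set ℝ) (u : ℝ → E3 → ℂ) : Prop :=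
  ENNReal.ofReal η₀ < normL10 I u ∧ normL10 I u ≤ ENNReal.ofReal (2 * η₀)

/-- The free evolution `t ↦ e^{i(t-s)Δ_D} u(s)` that agrees with `u` at time `s`; `u₋` and `u₊` are
the cases `s = t₋` and `s = t₊`. -/
def freeEvolution (s : ℝ) (u : ℝ → E3 → ℂ) (t : ℝ) : E3 → ℂ := freeProp (t - s) (u s)

/-- `I` is unexceptional: `‖u_±‖_{L¹⁰_{t,x}(I × Ω)} ≤ η₀¹⁰`. -/
def Unexceptional (η₀ tm tp : ℝ) (I : Set ℝ) (u : ℝ → E3 → ℂ) : Prop :=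
  normL10 I (freeEvolution tp u) ≤ ENNReal.ofReal (η₀ ^ 10) ∧
    normL10 I (freeEvolution tm u) ≤ ENNReal.ofReal (η₀ ^ 10)

end

end ExteriorNLS

open ExteriorNLS

open MeasureTheory Set Filter Topology

/-! The lower bound comes from an upper bound `‖u‖_{L¹⁰(I × Ω)}¹⁰ ≤ C |I|`. A radial function
vanishing on the unit sphere satisfies `|f(x)|² ≤ C ‖∇f‖² / |x|`, so a uniform bound on `‖∇u(t)‖`
gives `|u|¹⁰ ≤ C |x|⁻⁵`, which is integrable over `Ω` in dimension three. The uniform bound is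
conservation of energy together with the defocusing sign.

Most of the work is conservation of energy for strong solutions that have no regularity beyond
`Ḣ¹₀`. Let `V(ρ) = r f(r)` with `ρ = r - 1`, and `w = V'`. Then `V(0) = 0`, and `f ↦ w` embeds
radial `Ḣ¹₀(Ω)` in `L²(0,∞)`. The sine transform of `f` becomes the cosine transform `cosT` of `w`,
a self-adjoint unitary involution, and the free flow becomes the unitary group `prop`. The
nonlinearity becomes a continuous map `quintic` of `L²(0,∞)`, because `V / √(1 + ρ)` is bounded and
Hardy's inequality controls `V / (1 + ρ)`. Strong solutions thus become continuous solutions of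
Duhamel's formula in a Hilbert space (`IsStrongSolution.isMild`).

The Hamiltonian `‖w‖²/2 + potential w` is then differentiated directly, without regularising.
Unitarity gives an exact formula for the kinetic increment. In the potential increment, the free
part `prop τ w - w` need not be `O(τ)` in `L²`, but it is paired with the gradient of the potential,
which is `(-Δ)⁻¹` of the nonlinearity (`cosT_potGrad_ae`). The extra factor `l⁻²` turns `(e^{-il²τ}
- 1)/τ` into a bounded multiplier converging to `-i` (`inner_potGrad_prop_sub`). The limiting terms
cancel (`IsMild.hasDerivWithinAt_hamiltonian`). -/

namespace ExteriorNLS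

noncomputable section

open scoped ComplexConjugate ENNReal InnerProductSpace

/-! ### Calculus of complex-valued absolutely continuous functions. -/

section AbsolutelyContinuous

theorem _root_.AbsolutelyContinuousOnInterval.lipschitz_comp {X Y : Type*} [PseudoMetricSpace X]
    [PseudoMetricSpace Y] {f : ℝ → X} {a b : ℝ} (hf : AbsolutelyContinuousOnInterval f a b)
    {φ : X → Y} {K : NNReal} (hφ : LipschitzWith K φ) :
    AbsolutelyContinuousOnInterval (fun t => φ (f t)) a b := by
  have h := Tendsto.const_mul (K : ℝ) hf
  rw [mul_zero] at h
  refine squeeze_zero (fun t => Finset.sum_nonneg fun i _ => dist_nonneg) (fun t => ?_) h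
  rw [Finset.mul_sum]
  exact Finset.sum_le_sum fun i _ => hφ.dist_le_mul _ _

variable {f : ℝ → ℂ} {a b : ℝ}

theorem ac_re (hf : AbsolutelyContinuousOnInterval f a b) :
    AbsolutelyContinuousOnInterval (fun t => (f t).re) a b :=
  hf.lipschitz_comp (φ := Complex.re) (K := 1) (LipschitzWith.of_dist_le_mul fun x y => by
    simpa [Complex.dist_eq, Real.dist_eq] using Complex.abs_re_le_norm (x - y))

theorem ac_im (hf : AbsolutelyContinuousOnInterval f a b) :
    AbsolutelyContinuousOnInterval (fun t => (f t).im) a b :=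
  hf.lipschitz_comp (φ := Complex.im) (K := 1) (LipschitzWith.of_dist_le_mul fun x y => by
    simpa [Complex.dist_eq, Real.dist_eq] using Complex.abs_im_le_norm (x - y))

theorem ac_conj (hf : AbsolutelyContinuousOnInterval f a b) :
    AbsolutelyContinuousOnInterval (fun t => conj (f t)) a b :=
  hf.lipschitz_comp (φ := fun z : ℂ => conj z) (K := 1) (LipschitzWith.of_dist_le_mul fun x y => by
    simp [Complex.dist_eq, ← map_sub])

theorem ac_ofReal {g : ℝ → ℝ} (hg : AbsolutelyContinuousOnInterval g a b) :
    AbsolutelyContinuousOnInterval (fun t => (g t : ℂ)) a b :=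
  hg.lipschitz_comp (φ := fun x : ℝ => (x : ℂ)) (K := 1) (LipschitzWith.of_dist_le_mul fun x y => by
    simp [Complex.dist_eq, ← Complex.ofReal_sub, Real.dist_eq])

theorem ac_ae_differentiableAt (hf : AbsolutelyContinuousOnInterval f a b) :
    ∀ᵐ x : ℝ, x ∈ uIcc a b → DifferentiableAt ℝ f x := by
  filter_upwards [(ac_re hf).ae_differentiableAt, (ac_im hf).ae_differentiableAt] with x h1 h2 hx
  have h1' := (h1 hx).hasDerivAt.ofReal_comp
  have h2' := ((h2 hx).hasDerivAt.ofReal_comp).mul_const Complex.I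
  have := h1'.add h2'
  refine HasDerivAt.differentiableAt (this.congr_of_eventuallyEq (.of_forall fun y => ?_))
  simp [Complex.re_add_im]

/-- The real fundamental theorem of calculus is applied to real and imaginary parts. An arbitrary
a.e. derivative is allowed, so that closed formulas can be used in place of `deriv f`. -/
theorem ac_integral {f' : ℝ → ℂ} (hf : AbsolutelyContinuousOnInterval f a b)
    (h : ∀ᵐ x : ℝ, x ∈ uIcc a b → HasDerivAt f (f' x) x) :
    IntervalIntegrable f' volume a b ∧ ∫ x in a..b, f' x = f b - f a := by
  have hre := ac_re hf
  have him := ac_im hf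
  have hsub : ∀ x, x ∈ uIoc a b → x ∈ uIcc a b := fun x hx => uIoc_subset_uIcc hx
  have hEq : (fun x => ((deriv (fun t => (f t).re) x : ℝ) : ℂ) +
      ((deriv (fun t => (f t).im) x : ℝ) : ℂ) * Complex.I)
      =ᵐ[volume.restrict (uIoc a b)] f' := by
    rw [EventuallyEq, ae_restrict_iff' measurableSet_uIoc]
    filter_upwards [h] with x hx hxm
    have hd := hx (hsub x hxm)
    have h1 : HasDerivAt (fun t => (f t).re) (f' x).re x := by
      exact Complex.reCLM.hasFDerivAt.comp_hasDerivAt x hd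
    have h2 : HasDerivAt (fun t => (f t).im) (f' x).im x := by
      exact Complex.imCLM.hasFDerivAt.comp_hasDerivAt x hd
    rw [h1.deriv, h2.deriv, Complex.re_add_im]
  have i1 : IntervalIntegrable (fun x => ((deriv (fun t => (f t).re) x : ℝ) : ℂ)) volume a b :=
    ⟨hre.intervalIntegrable_deriv.1.ofReal, hre.intervalIntegrable_deriv.2.ofReal⟩
  have i2 : IntervalIntegrable (fun x => ((deriv (fun t => (f t).im) x : ℝ) : ℂ) * Complex.I)
      volume a b :=
    (show IntervalIntegrable (fun x => ((deriv (fun t => (f t).im) x : ℝ) : ℂ)) volume a b from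
    ⟨him.intervalIntegrable_deriv.1.ofReal, him.intervalIntegrable_deriv.2.ofReal⟩).mul_const _
  refine ⟨(i1.add i2).congr_ae hEq, ?_⟩
  rw [← intervalIntegral.integral_congr_ae_restrict hEq, intervalIntegral.integral_add i1 i2,
    intervalIntegral.integral_mul_const, intervalIntegral.integral_ofReal,
    intervalIntegral.integral_ofReal, hre.integral_deriv_eq_sub, him.integral_deriv_eq_sub]
  apply Complex.ext <;> simp

theorem ac_primitive {w : ℝ → ℂ} (hw : IntervalIntegrable w volume a b) :
    AbsolutelyContinuousOnInterval (fun x => ∫ s in a..x, w s) a b := by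
  have i1 : IntervalIntegrable (fun s => (w s).re) volume a b := ⟨hw.1.re, hw.2.re⟩
  have i2 : IntervalIntegrable (fun s => (w s).im) volume a b := ⟨hw.1.im, hw.2.im⟩
  have h1 := ac_ofReal (i1.absolutelyContinuousOnInterval_intervalIntegral (c := a) (by simp))
  have h2 := ac_ofReal (i2.absolutelyContinuousOnInterval_intervalIntegral (c := a) (by simp))
  have h := h1.add (h2.const_smul Complex.I)
  refine (Tendsto.congr' ?_ h)
  have : ∀ x ∈ uIcc a b, ((fun x => ((∫ v in a..x, (w v).re : ℝ) : ℂ)) +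
      fun x => Complex.I • ((∫ v in a..x, (w v).im : ℝ) : ℂ)) x = ∫ s in a..x, w s := by
    intro x hx
    have hx' : IntervalIntegrable w volume a x := hw.mono_set (uIcc_subset_uIcc_left hx)
    simp only [Pi.add_apply, smul_eq_mul]
    rw [← intervalIntegral.integral_ofReal, ← intervalIntegral.integral_ofReal,
      ← intervalIntegral.integral_const_mul, ← intervalIntegral.integral_add]
    · refine intervalIntegral.integral_congr fun v _ => ?_
      rw [mul_comm, Complex.re_add_im]
    · exact ⟨hx'.1.re.ofReal, hx'.2.re.ofReal⟩
    · exact (show IntervalIntegrable (fun v => ((w v).im : ℂ)) volume a x from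
        ⟨hx'.1.im.ofReal, hx'.2.im.ofReal⟩).const_mul _
  refine eventually_inf_principal.2 (.of_forall fun E hE => Finset.sum_congr rfl fun i hi => ?_)
  rw [this _ (hE.1 i hi).1, this _ (hE.1 i hi).2]

theorem ae_eq_zero_of_primitive_eq_zero {f : ℝ → ℂ}
    (hint : ∀ R : ℝ, 0 < R → IntervalIntegrable f volume 0 R)
    (h : ∀ R : ℝ, 0 < R → ∫ s in (0 : ℝ)..R, f s = 0) :
    ∀ᵐ x ∂(volume.restrict (Ioi (0 : ℝ))), f x = 0 := by
  -- Lebesgue differentiation on each `[0, n + 1]`; countably many intervals leave a single null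
  -- set.
  have hn : ∀ n : ℕ, ∀ᵐ x : ℝ, x ∈ uIcc 0 ((n : ℝ) + 1) →
      ∀ c ∈ uIcc 0 ((n : ℝ) + 1), HasDerivAt (fun x => ∫ t in c..x, f t) (f x) x := fun n =>
    (hint (n + 1) (by positivity)).ae_hasDerivAt_integral
  rw [ae_restrict_iff' measurableSet_Ioi]
  filter_upwards [ae_all_iff.2 hn] with x hx hx0
  obtain ⟨n, hn⟩ := exists_nat_ge x
  have h0 : (0 : ℝ) ≤ n + 1 := by positivity
  have hd := hx n (by rw [uIcc_of_le h0]; exact ⟨le_of_lt hx0, by linarith⟩) 0 (by simp)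
  have h2 : HasDerivAt (fun x => ∫ t in (0 : ℝ)..x, f t) 0 x :=
    (hasDerivAt_const x (0 : ℂ)).congr_of_eventuallyEq (by
      filter_upwards [Ioi_mem_nhds hx0] with y hy using h y hy)
  exact hd.unique h2

end AbsolutelyContinuous

/-! ### The Hilbert space `L²(0,∞)`, indicators and primitives. -/

section HalfLine

/-- Lebesgue measure on the half-line. -/
abbrev volHalf : Measure ℝ := (volume : Measure ℝ).restrict (Ioi 0)

/-- Square-integrable complex functions on the half-line. -/
abbrev HalfL2 : Type := Lp ℂ 2 volHalf

theorem volHalf_Ioc (ρ : ℝ) : volHalf (Ioc 0 ρ) = ENNReal.ofReal ρ := by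
  rw [Measure.restrict_apply measurableSet_Ioc,
    inter_eq_left.2 (fun x hx => hx.1), Real.volume_Ioc, sub_zero]

/-- The indicator function of `(0, ρ]`. -/
def ind (ρ : ℝ) : HalfL2 :=
  indicatorConstLp 2 (measurableSet_Ioc : MeasurableSet (Ioc (0 : ℝ) ρ))
    (by rw [volHalf_Ioc]; exact ENNReal.ofReal_ne_top) (1 : ℂ)

/-- The primitive of `w` vanishing at the origin. -/
def prim (w : HalfL2) (ρ : ℝ) : ℂ := inner ℂ (ind ρ) w

theorem restrict_volHalf_Ioc (ρ : ℝ) : volHalf.restrict (Ioc 0 ρ) = volume.restrict (Ioc 0 ρ) := by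
  rw [Measure.restrict_restrict measurableSet_Ioc, inter_eq_left.2 (fun x hx => hx.1)]

theorem prim_eq_setIntegral (w : HalfL2) (ρ : ℝ) : prim w ρ = ∫ s in Ioc 0 ρ, w s := by
  rw [prim, ind, L2.inner_indicatorConstLp_one, restrict_volHalf_Ioc]

theorem prim_eq_integral (w : HalfL2) {ρ : ℝ} (hρ : 0 ≤ ρ) :
    prim w ρ = ∫ s in (0 : ℝ)..ρ, w s := by
  rw [prim_eq_setIntegral, intervalIntegral.integral_of_le hρ]

theorem norm_ind {ρ : ℝ} (hρ : 0 ≤ ρ) : ‖ind ρ‖ = √ρ := by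
  rw [ind, norm_indicatorConstLp (by norm_num) (by norm_num)]
  simp [Measure.real, ENNReal.toReal_ofReal hρ, Real.sqrt_eq_rpow]

theorem ind_of_nonpos {ρ : ℝ} (hρ : ρ ≤ 0) : ind ρ = 0 := by
  simp [ind, Ioc_eq_empty (not_lt.2 hρ)]

/-- Cauchy–Schwarz against the indicator of `(0, ρ]`. This is the radial Sobolev inequality in
reduced form, and the source of every pointwise bound below. -/
theorem norm_prim_le (w : HalfL2) (ρ : ℝ) : ‖prim w ρ‖ ≤ √ρ * ‖w‖ := by
  rcases le_total ρ 0 with h | h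
  · simp [prim, ind_of_nonpos h]; positivity
  · rw [← norm_ind h]; exact norm_inner_le_norm _ _

theorem prim_add (v w : HalfL2) (ρ : ℝ) : prim (v + w) ρ = prim v ρ + prim w ρ :=
  inner_add_right _ _ _

theorem prim_sub (v w : HalfL2) (ρ : ℝ) : prim (v - w) ρ = prim v ρ - prim w ρ :=
  inner_sub_right _ _ _

theorem prim_smul (c : ℂ) (w : HalfL2) (ρ : ℝ) : prim (c • w) ρ = c * prim w ρ :=
  inner_smul_right _ _ _

theorem halfL2_memLp (w : HalfL2) : MemLp w 2 volHalf := Lp.memLp w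

theorem halfL2_intervalIntegrable (w : HalfL2) {a b : ℝ} (ha : 0 ≤ a) (hb : 0 ≤ b) :
    IntervalIntegrable w volume a b := by
  rw [intervalIntegrable_iff]
  have hsub : uIoc a b ⊆ Ioi 0 := fun x hx => lt_of_le_of_lt (le_min ha hb) hx.1
  have h1 : MemLp w 2 (volume.restrict (uIoc a b)) := (halfL2_memLp w).mono_measure
    (Measure.restrict_mono hsub le_rfl)
  have : IsFiniteMeasure (volume.restrict (uIoc a b)) := ⟨by simp [uIoc, Real.volume_Ioc]⟩
  exact h1.integrable (by norm_num)

theorem prim_ac (w : HalfL2) {R : ℝ} (hR : 0 ≤ R) :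
    AbsolutelyContinuousOnInterval (prim w) 0 R := by
  refine Tendsto.congr' ?_ (ac_primitive (halfL2_intervalIntegrable w le_rfl hR))
  refine eventually_inf_principal.2 (.of_forall fun E hE => Finset.sum_congr rfl fun i hi => ?_)
  have h := hE.1 i hi
  rw [uIcc_of_le hR] at h
  rw [prim_eq_integral w h.1.1, prim_eq_integral w h.2.1]

theorem prim_ae_hasDerivAt (w : HalfL2) {R : ℝ} (hR : 0 ≤ R) :
    ∀ᵐ x : ℝ, x ∈ uIcc 0 R → HasDerivAt (prim w) (w x) x := by
  filter_upwards [(halfL2_intervalIntegrable w le_rfl hR).ae_hasDerivAt_integral,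
    compl_mem_ae_iff.2 (measure_singleton (0 : ℝ))] with x hx h0 hxm
  have hx0 : 0 < x := by
    rw [uIcc_of_le hR] at hxm
    exact lt_of_le_of_ne hxm.1 (Ne.symm h0)
  refine (hx hxm 0 (by simp)).congr_of_eventuallyEq ?_
  filter_upwards [Ioi_mem_nhds hx0] with y hy using prim_eq_integral w (le_of_lt hy)

theorem eq_zero_of_prim_eq_zero {w : HalfL2} (h : ∀ ρ, 0 < ρ → prim w ρ = 0) : w = 0 := by
  refine Lp.eq_zero_iff_ae_eq_zero.2 ?_
  exact ae_eq_zero_of_primitive_eq_zero (fun R hR => halfL2_intervalIntegrable w le_rfl hR.le)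
    (fun R hR => by rw [← prim_eq_integral w hR.le, h R hR])

theorem ext_prim {v w : HalfL2} (h : ∀ ρ, 0 < ρ → prim v ρ = prim w ρ) : v = w :=
  sub_eq_zero.1 (eq_zero_of_prim_eq_zero fun ρ hρ => by rw [prim_sub, h ρ hρ, sub_self])

theorem inner_ind_ind {ρ σ : ℝ} (hρ : 0 ≤ ρ) (hσ : 0 ≤ σ) :
    inner ℂ (ind ρ) (ind σ) = ((min ρ σ : ℝ) : ℂ) := by
  change prim (ind σ) ρ = _
  rw [prim, ind, ind, L2.inner_indicatorConstLp_indicatorConstLp _ _ (by simp) (by simp)]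
  simp [Ioc_inter_Ioc, Measure.real, -ENNReal.ofReal_min, ENNReal.toReal_ofReal (le_min hρ hσ)]

theorem continuous_prim (w : HalfL2) : Continuous (prim w) := by
  have h : Continuous fun x : ℝ => prim w (max x 0) := by
    have hc : ContinuousOn (prim w) (Ici 0) := by
      intro x hx
      have hx1 : (0 : ℝ) ≤ x + 1 := by have := mem_Ici.1 hx; linarith
      have := (prim_ac w hx1).continuousOn x (by
        rw [uIcc_of_le hx1]; exact ⟨hx, by linarith⟩)
      refine this.mono_of_mem_nhdsWithin ?_
      rw [uIcc_of_le hx1, ← Ici_inter_Iic]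
      exact inter_mem self_mem_nhdsWithin (mem_nhdsWithin_of_mem_nhds (Iic_mem_nhds (by linarith)))
    exact hc.comp_continuous (by fun_prop) fun x => mem_Ici.2 (le_max_right _ _)
  refine h.congr fun x => ?_
  rcases le_total x 0 with h | h
  · rw [max_eq_right h, prim, prim, ind_of_nonpos h, ind_of_nonpos le_rfl]
  · rw [max_eq_left h]

/-- A vector orthogonal to all indicators has vanishing primitive, hence is zero by Lebesgue
differentiation. -/
theorem dense_span_ind : DenseRange (Finsupp.linearCombination ℂ (fun ρ : Ioi (0 : ℝ) => ind ρ)) := by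
  rw [DenseRange, ← LinearMap.coe_range, Finsupp.range_linearCombination,
    Submodule.dense_iff_topologicalClosure_eq_top, Submodule.topologicalClosure_eq_top_iff,
    Submodule.eq_bot_iff]
  intro w hw
  refine eq_zero_of_prim_eq_zero fun ρ hρ => ?_
  exact (Submodule.mem_orthogonal _ _).1 hw _ (Submodule.subset_span ⟨⟨ρ, hρ⟩, rfl⟩)

end HalfLine

/-! ### Multiplication operators by bounded continuous functions. -/

section Multiplication

open BoundedContinuousFunction

theorem memLp_bcf_mul (φ : ℝ →ᵇ ℂ) (w : HalfL2) : MemLp (fun x => φ x * w x) 2 volHalf := by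
  refine (halfL2_memLp w).of_le_mul (c := ‖φ‖)
    (φ.continuous.aestronglyMeasurable.mul (Lp.aestronglyMeasurable w)) (.of_forall fun x => ?_)
  rw [norm_mul]
  exact mul_le_mul_of_nonneg_right (φ.norm_coe_le_norm x) (norm_nonneg _)

/-- Multiplication of square-integrable functions by bounded continuous functions. -/
def mulBCF : (ℝ →ᵇ ℂ) →L[ℂ] HalfL2 →L[ℂ] HalfL2 :=
  LinearMap.mkContinuous₂
    (LinearMap.mk₂ ℂ (fun φ w => (memLp_bcf_mul φ w).toLp _)
      (fun φ ψ w => by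
        rw [← MemLp.toLp_add]; congr 1; ext x; simp [add_mul])
      (fun c φ w => by
        rw [← MemLp.toLp_const_smul]; congr 1; ext x; simp [mul_assoc])
      (fun φ v w => by
        rw [← MemLp.toLp_add]
        refine (MemLp.toLp_eq_toLp_iff _ _).2 ?_
        filter_upwards [Lp.coeFn_add v w] with x hx
        rw [hx]; simp only [Pi.add_apply, mul_add])
      (fun c φ w => by
        rw [← MemLp.toLp_const_smul]
        refine (MemLp.toLp_eq_toLp_iff _ _).2 ?_
        filter_upwards [Lp.coeFn_smul c w] with x hx
        rw [hx]; simp only [Pi.smul_apply, smul_eq_mul, mul_left_comm]))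
    1 (fun φ w => by
      rw [one_mul]
      refine Lp.norm_le_mul_norm_of_ae_le_mul ?_
      filter_upwards [(memLp_bcf_mul φ w).coeFn_toLp] with x hx
      rw [LinearMap.mk₂_apply, hx, norm_mul]
      exact mul_le_mul_of_nonneg_right (φ.norm_coe_le_norm x) (norm_nonneg _))

theorem coeFn_mulBCF (φ : ℝ →ᵇ ℂ) (w : HalfL2) :
    mulBCF φ w =ᵐ[volHalf] fun x => φ x * w x := (memLp_bcf_mul φ w).coeFn_toLp

theorem norm_mulBCF_le (φ : ℝ →ᵇ ℂ) (w : HalfL2) : ‖mulBCF φ w‖ ≤ ‖φ‖ * ‖w‖ := by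
  refine Lp.norm_le_mul_norm_of_ae_le_mul ?_
  filter_upwards [coeFn_mulBCF φ w] with x hx
  rw [hx, norm_mul]
  exact mul_le_mul_of_nonneg_right (φ.norm_coe_le_norm x) (norm_nonneg _)

theorem mulBCF_mul (φ ψ : ℝ →ᵇ ℂ) (w : HalfL2) :
    mulBCF (φ * ψ) w = mulBCF φ (mulBCF ψ w) := by
  refine Lp.ext ?_
  filter_upwards [coeFn_mulBCF (φ * ψ) w, coeFn_mulBCF φ (mulBCF ψ w), coeFn_mulBCF ψ w]
    with x h1 h2 h3
  rw [h1, h2, h3, BoundedContinuousFunction.mul_apply, mul_assoc]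

theorem mulBCF_one (w : HalfL2) : mulBCF 1 w = w := by
  refine Lp.ext ?_
  filter_upwards [coeFn_mulBCF 1 w] with x h1
  simp [h1]

theorem norm_sq_eq_integral (w : HalfL2) : ‖w‖ ^ 2 = ∫ x in Ioi (0 : ℝ), ‖w x‖ ^ 2 := by
  have h := congrArg Complex.re (inner_self_eq_norm_sq_to_K (𝕜 := ℂ) w)
  rw [L2.inner_def] at h
  have h2 : (∫ x in Ioi (0 : ℝ), inner ℂ (w x) (w x)) =
      ((∫ x in Ioi (0 : ℝ), ‖w x‖ ^ 2 : ℝ) : ℂ) := by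
    rw [← integral_complex_ofReal]
    refine integral_congr_ae (.of_forall fun x => ?_)
    simp only [inner_self_eq_norm_sq_to_K]
    norm_cast
  rw [h2] at h
  simpa [← Complex.ofReal_pow] using h.symm

theorem integrable_norm_sq (w : HalfL2) : IntegrableOn (fun x => ‖w x‖ ^ 2) (Ioi 0) :=
  (halfL2_memLp w).integrable_norm_pow (by norm_num)

/-- Dominated convergence for the squared norm: uniformly bounded multipliers converging pointwise
converge strongly. Neither the free phases nor their difference quotients converge in the uniform
norm, so this is the continuity that can be used. -/
theorem tendsto_mulBCF {ι : Type*} {l : Filter ι} [l.IsCountablyGenerated] {φ : ι → ℝ →ᵇ ℂ}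
    {ψ : ℝ →ᵇ ℂ} {C : ℝ} (hb : ∀ᶠ i in l, ‖φ i‖ ≤ C)
    (h : ∀ x, 0 < x → Tendsto (fun i => φ i x) l (𝓝 (ψ x))) (w : HalfL2) :
    Tendsto (fun i => mulBCF (φ i) w) l (𝓝 (mulBCF ψ w)) := by
  rw [tendsto_iff_norm_sub_tendsto_zero]
  have hsq : Tendsto (fun i => ‖mulBCF (φ i) w - mulBCF ψ w‖ ^ 2) l (𝓝 0) := by
    have e : ∀ i, ‖mulBCF (φ i) w - mulBCF ψ w‖ ^ 2 =
        ∫ x in Ioi (0 : ℝ), (‖φ i x - ψ x‖ * ‖w x‖) ^ 2 := fun i => by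
      rw [← _root_.sub_apply, ← map_sub, norm_sq_eq_integral]
      refine integral_congr_ae ?_
      filter_upwards [coeFn_mulBCF (φ i - ψ) w] with x hx
      rw [hx, norm_mul]; simp
    simp_rw [e]
    suffices hs : Tendsto (fun i => ∫ x in Ioi (0 : ℝ), (‖φ i x - ψ x‖ * ‖w x‖) ^ 2) l
        (𝓝 (∫ _x in Ioi (0 : ℝ), (0 : ℝ))) by simpa using hs
    refine tendsto_integral_filter_of_dominated_convergence (l := l)
      (fun x => (C + ‖ψ‖) ^ 2 * ‖w x‖ ^ 2) ?_ ?_ ?_ ?_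
    · refine .of_forall fun i => ?_
      have h1 : Continuous fun x => ‖φ i x - ψ x‖ := by fun_prop
      exact (h1.aestronglyMeasurable.mul (Lp.aestronglyMeasurable w).norm).pow 2
    · filter_upwards [hb] with i hi
      refine .of_forall fun x => ?_
      rw [Real.norm_of_nonneg (by positivity), mul_pow]
      gcongr
      exact (norm_sub_le _ _).trans (add_le_add ((φ i).norm_coe_le_norm x |>.trans hi)
        (ψ.norm_coe_le_norm x))
    · exact (integrable_norm_sq w).const_mul _
    · filter_upwards [ae_restrict_mem measurableSet_Ioi] with x hx
      have := (((h x hx).sub_const (ψ x)).norm.mul_const ‖w x‖).pow 2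
      simpa using this
  have := hsq.sqrt
  simpa [Real.sqrt_sq (norm_nonneg _)] using this

end Multiplication

/-! ### Gram matrix of the sine kernels. -/

section SineKernel

theorem lintegral_Ioi_of_hasDerivAt {g g' : ℝ → ℝ} (hd : ∀ x ∈ Ici (0 : ℝ), HasDerivAt g (g' x) x)
    (hn : ∀ x ∈ Ioi (0 : ℝ), 0 ≤ g' x) (hl : Tendsto g atTop (𝓝 0)) :
    ∫⁻ x in Ioi (0 : ℝ), ENNReal.ofReal (g' x) = ENNReal.ofReal (-g 0) := by
  rw [← ofReal_integral_eq_lintegral_ofReal (integrableOn_Ioi_deriv_of_nonneg' hd hn hl)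
    ((ae_restrict_iff' measurableSet_Ioi).2 (.of_forall hn)),
    integral_Ioi_of_hasDerivAt_of_nonneg' hd hn hl, zero_sub]

theorem tendsto_exp_neg_mul_atTop {s : ℝ} (hs : 0 < s) :
    Tendsto (fun l : ℝ => Real.exp (-(s * l))) atTop (𝓝 0) :=
  Real.tendsto_exp_neg_atTop_nhds_zero.comp (tendsto_id.const_mul_atTop hs)

theorem lintegral_mul_exp_neg {l : ℝ} (hl : 0 < l) :
    ∫⁻ s in Ioi (0 : ℝ), ENNReal.ofReal (s * Real.exp (-(l * s))) = ENNReal.ofReal (1 / l ^ 2) := by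
  have h := lintegral_Ioi_of_hasDerivAt (g := fun s => -(s / l + 1 / l ^ 2) * Real.exp (-(l * s)))
    (g' := fun s => s * Real.exp (-(l * s))) ?_ ?_ ?_
  · rw [h]; simp
  · intro s _
    have h1 : HasDerivAt (fun s : ℝ => -(s / l + 1 / l ^ 2)) (-(1 / l)) s :=
      (((hasDerivAt_id s).div_const l).add_const _).neg
    have h2 : HasDerivAt (fun s : ℝ => Real.exp (-(l * s))) (Real.exp (-(l * s)) * (-(l * 1))) s :=
      (((hasDerivAt_id s).const_mul l).neg).exp
    refine (h1.mul h2).congr_deriv ?_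
    field_simp
    ring
  · intro s hs
    have := mem_Ioi.1 hs
    positivity
  · have h1 : Tendsto (fun s : ℝ => s * Real.exp (-(l * s))) atTop (𝓝 0) := by
      have := tendsto_rpow_mul_exp_neg_mul_atTop_nhds_zero 1 l hl
      simpa using this
    have := ((h1.const_mul (1 / l)).add ((tendsto_exp_neg_mul_atTop hl).const_mul (1 / l ^ 2))).neg
    simp only [mul_zero, add_zero, neg_zero] at this
    refine this.congr fun s => ?_
    ring

theorem lintegral_one_sub_cos_mul_exp_neg {s : ℝ} (hs : 0 < s) :
    ∫⁻ l in Ioi (0 : ℝ), ENNReal.ofReal ((1 - Real.cos l) * (s * Real.exp (-(l * s)))) =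
      ENNReal.ofReal ((1 + s ^ 2)⁻¹) := by
  have h := lintegral_Ioi_of_hasDerivAt
    (g := fun l => Real.exp (-(s * l)) *
      (-1 - s / (1 + s ^ 2) * (Real.sin l - s * Real.cos l)))
    (g' := fun l => (1 - Real.cos l) * (s * Real.exp (-(l * s)))) ?_ ?_ ?_
  · rw [h]; congr 1; simp; field_simp; ring
  · intro l _
    have h1 : HasDerivAt (fun l : ℝ => Real.exp (-(s * l))) (Real.exp (-(s * l)) * (-(s * 1))) l :=
      (((hasDerivAt_id l).const_mul s).neg).exp
    have h2 : HasDerivAt (fun l : ℝ => -1 - s / (1 + s ^ 2) * (Real.sin l - s * Real.cos l))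
        (-(s / (1 + s ^ 2) * (Real.cos l - s * (-Real.sin l)))) l :=
      (((Real.hasDerivAt_sin l).sub ((Real.hasDerivAt_cos l).const_mul s)).const_mul _).const_sub _
    refine (h1.mul h2).congr_deriv ?_
    rw [mul_comm l s]
    field_simp
    ring
  · intro l _
    have := Real.cos_le_one l
    have : 0 ≤ 1 - Real.cos l := by linarith
    positivity
  · have hb : ∀ l, |(-1 - s / (1 + s ^ 2) * (Real.sin l - s * Real.cos l))| ≤
        1 + s / (1 + s ^ 2) * (1 + s) := fun l => by
      have h1 := Real.abs_sin_le_one l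
      have h2 := Real.abs_cos_le_one l
      have h3 : |Real.sin l - s * Real.cos l| ≤ 1 + s := by
        refine (abs_sub _ _).trans (add_le_add h1 ?_)
        rw [abs_mul, abs_of_pos hs]
        exact mul_le_of_le_one_right hs.le h2
      refine (abs_sub _ _).trans (add_le_add (by simp) ?_)
      rw [abs_mul, abs_of_pos (show 0 < s / (1 + s ^ 2) by positivity)]
      gcongr
    refine squeeze_zero_norm (fun l => ?_)
      (a := fun l => Real.exp (-(s * l)) * (1 + s / (1 + s ^ 2) * (1 + s))) ?_
    · rw [norm_mul, Real.norm_of_nonneg (Real.exp_nonneg _)]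
      exact mul_le_mul_of_nonneg_left (hb l) (Real.exp_nonneg _)
    · simpa using (tendsto_exp_neg_mul_atTop hs).mul_const (1 + s / (1 + s ^ 2) * (1 + s))

/-- Write `1/l² = ∫ s e^{-ls} ds` and exchange the integrals by Tonelli; the inner integral becomes
`1/(1 + s²)`. -/
theorem lintegral_one_sub_cos_div_sq :
    ∫⁻ l in Ioi (0 : ℝ), ENNReal.ofReal ((1 - Real.cos l) / l ^ 2) =
      ENNReal.ofReal (Real.pi / 2) := by
  have h1 : ∫⁻ l in Ioi (0 : ℝ), ENNReal.ofReal ((1 - Real.cos l) / l ^ 2) =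
      ∫⁻ l in Ioi (0 : ℝ), ∫⁻ s in Ioi (0 : ℝ),
        ENNReal.ofReal ((1 - Real.cos l) * (s * Real.exp (-(l * s)))) := by
    refine setLIntegral_congr_fun measurableSet_Ioi fun l hl => ?_
    have hc : 0 ≤ 1 - Real.cos l := by have := Real.cos_le_one l; linarith
    simp_rw [ENNReal.ofReal_mul hc]
    rw [lintegral_const_mul _ (by fun_prop), lintegral_mul_exp_neg hl, ← ENNReal.ofReal_mul hc]
    congr 1
    ring
  rw [h1, lintegral_lintegral_swap (by fun_prop)]
  rw [setLIntegral_congr_fun measurableSet_Ioi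
    (fun s hs => lintegral_one_sub_cos_mul_exp_neg hs)]
  rw [← ofReal_integral_eq_lintegral_ofReal integrable_inv_one_add_sq.integrableOn
    (.of_forall fun s => by positivity), integral_Ioi_inv_one_add_sq]
  simp

theorem integrableOn_one_sub_cos_div_sq :
    IntegrableOn (fun l : ℝ => (1 - Real.cos l) / l ^ 2) (Ioi 0) := by
  refine ⟨(show Measurable _ by fun_prop).aestronglyMeasurable, ?_⟩
  rw [hasFiniteIntegral_iff_ofReal (.of_forall fun l => ?_), lintegral_one_sub_cos_div_sq]
  · exact ENNReal.ofReal_lt_top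
  · have := Real.cos_le_one l
    exact div_nonneg (by linarith) (by positivity)

theorem integral_one_sub_cos_div_sq :
    ∫ l in Ioi (0 : ℝ), (1 - Real.cos l) / l ^ 2 = Real.pi / 2 := by
  rw [integral_eq_lintegral_of_nonneg_ae (.of_forall fun l => ?_)
    (show Measurable _ by fun_prop).aestronglyMeasurable, lintegral_one_sub_cos_div_sq, ENNReal.toReal_ofReal (by positivity)]
  have := Real.cos_le_one l
  exact div_nonneg (by linarith) (by positivity)

theorem one_sub_cos_mul_div_sq (a : ℝ) :
    IntegrableOn (fun l : ℝ => (1 - Real.cos (a * l)) / l ^ 2) (Ioi 0) ∧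
      ∫ l in Ioi (0 : ℝ), (1 - Real.cos (a * l)) / l ^ 2 = Real.pi / 2 * |a| := by
  wlog ha : 0 ≤ a with H
  · have := H (-a) (by linarith)
    simpa using this
  rcases ha.eq_or_lt with rfl | ha
  · simp
  have e : (fun l : ℝ => (1 - Real.cos (a * l)) / l ^ 2) =
      fun l => a ^ 2 * ((1 - Real.cos (a * l)) / (a * l) ^ 2) := by
    ext l
    rw [mul_pow, ← mul_div_assoc, mul_div_mul_left _ _ (by positivity)]
  rw [e]
  have h1 := (integrableOn_Ioi_comp_mul_left_iff (fun l : ℝ => (1 - Real.cos l) / l ^ 2) 0 ha).2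
    (by simpa using integrableOn_one_sub_cos_div_sq)
  refine ⟨h1.const_mul _, ?_⟩
  rw [integral_const_mul, integral_comp_mul_left_Ioi (fun l : ℝ => (1 - Real.cos l) / l ^ 2) 0 ha,
    mul_zero, integral_one_sub_cos_div_sq, abs_of_pos ha, smul_eq_mul]
  field_simp

/-- The kernel of the sine transform, divided by the frequency. -/
def sineFun (ρ l : ℝ) : ℝ := √(2 / Real.pi) * (Real.sin (l * ρ) / l)

/-- Product-to-sum formula. The constant `1` is added and subtracted so that each quotient is
integrable at the origin by itself. -/
theorem sineFun_mul (ρ σ l : ℝ) : sineFun ρ l * sineFun σ l =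
    1 / Real.pi * ((1 - Real.cos ((ρ + σ) * l)) / l ^ 2 - (1 - Real.cos ((ρ - σ) * l)) / l ^ 2) := by
  have h : √(2 / Real.pi) * √(2 / Real.pi) = 2 / Real.pi := Real.mul_self_sqrt (by positivity)
  have hs : Real.cos ((ρ - σ) * l) - Real.cos ((ρ + σ) * l) =
      2 * (Real.sin (l * ρ) * Real.sin (l * σ)) := by
    rw [show (ρ - σ) * l = l * ρ - l * σ by ring, show (ρ + σ) * l = l * ρ + l * σ by ring,
      Real.cos_sub, Real.cos_add]
    ring
  calc sineFun ρ l * sineFun σ l = (√(2 / Real.pi) * √(2 / Real.pi)) *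
      (Real.sin (l * ρ) * Real.sin (l * σ)) / l ^ 2 := by simp only [sineFun]; ring
    _ = 1 / Real.pi * (2 * (Real.sin (l * ρ) * Real.sin (l * σ))) / l ^ 2 := by rw [h]; ring
    _ = _ := by rw [← hs]; ring

theorem integrable_sineFun_mul (ρ σ : ℝ) :
    IntegrableOn (fun l => sineFun ρ l * sineFun σ l) (Ioi 0) := by
  simp_rw [sineFun_mul]
  exact ((one_sub_cos_mul_div_sq _).1.sub (one_sub_cos_mul_div_sq _).1).const_mul _

/-- The value is `((ρ + σ) - |ρ - σ|)/2`. The sine kernels therefore have the same Gram matrix as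
the indicators, which is Plancherel's identity for the cosine transform. -/
theorem integral_sineFun_mul {ρ σ : ℝ} (hρ : 0 ≤ ρ) (hσ : 0 ≤ σ) :
    ∫ l in Ioi (0 : ℝ), sineFun ρ l * sineFun σ l = min ρ σ := by
  simp_rw [sineFun_mul]
  rw [integral_const_mul, integral_sub (one_sub_cos_mul_div_sq _).1 (one_sub_cos_mul_div_sq _).1,
    (one_sub_cos_mul_div_sq _).2, (one_sub_cos_mul_div_sq _).2, abs_of_nonneg (add_nonneg hρ hσ)]
  rw [min_def]
  have := Real.pi_pos
  split_ifs with h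
  · rw [abs_of_nonpos (by linarith)]; field_simp; ring
  · rw [abs_of_nonneg (by linarith)]; field_simp; ring

theorem memLp_sineFun (ρ : ℝ) : MemLp (fun l => (sineFun ρ l : ℂ)) 2 volHalf := by
  have hm : Measurable (sineFun ρ) := by unfold sineFun; fun_prop
  have : MemLp (sineFun ρ) 2 volHalf :=
    (memLp_two_iff_integrable_sq hm.aestronglyMeasurable).2 (by
      simp_rw [sq]; exact integrable_sineFun_mul ρ ρ)
  exact this.ofReal

/-- The kernel of the sine transform as an element of `HalfL2`. -/
def sineKer (ρ : ℝ) : HalfL2 := (memLp_sineFun ρ).toLp _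

theorem coeFn_sineKer (ρ : ℝ) : sineKer ρ =ᵐ[volHalf] fun l => (sineFun ρ l : ℂ) :=
  (memLp_sineFun ρ).coeFn_toLp

theorem inner_sineKer_left (ρ : ℝ) (w : HalfL2) :
    inner ℂ (sineKer ρ) w = ∫ l in Ioi (0 : ℝ), (sineFun ρ l : ℂ) * w l := by
  rw [L2.inner_def]
  refine integral_congr_ae ?_
  filter_upwards [coeFn_sineKer ρ] with l hl
  rw [hl]
  simp [mul_comm]

theorem inner_sineKer_sineKer {ρ σ : ℝ} (hρ : 0 ≤ ρ) (hσ : 0 ≤ σ) :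
    inner ℂ (sineKer ρ) (sineKer σ) = ((min ρ σ : ℝ) : ℂ) := by
  rw [inner_sineKer_left, ← integral_sineFun_mul hρ hσ, ← integral_complex_ofReal]
  refine integral_congr_ae ?_
  filter_upwards [coeFn_sineKer σ] with l hl
  rw [hl]
  simp

/-- Rescaling leaves a real function of the product `σ * ρ` alone; that symmetry makes `cosT`
self-adjoint. -/
theorem inner_ind_sineKer {ρ σ : ℝ} (hσ : 0 ≤ σ) :
    inner ℂ (ind σ) (sineKer ρ) =
      ((√(2 / Real.pi) * ∫ x in (0 : ℝ)..(σ * ρ), Real.sinc x : ℝ) : ℂ) := by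
  change prim _ _ = _
  rw [prim_eq_integral _ hσ]
  have e : ∫ s in (0 : ℝ)..σ, (sineKer ρ) s =
      ∫ s in (0 : ℝ)..σ, ((√(2 / Real.pi) * (ρ * Real.sinc (s * ρ)) : ℝ) : ℂ) := by
    refine intervalIntegral.integral_congr_ae ?_
    rw [uIoc_of_le hσ]
    have := coeFn_sineKer ρ
    rw [EventuallyEq, ae_restrict_iff' measurableSet_Ioi] at this
    filter_upwards [this] with s hs hm
    rw [hs hm.1, sineFun]
    congr 2
    rcases eq_or_ne ρ 0 with rfl | hρ
    · simp
    · have h0 := (mem_Ioc.1 hm).1.ne'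
      rw [Real.sinc_of_ne_zero (mul_ne_zero h0 hρ)]
      field_simp
  rw [e, intervalIntegral.integral_ofReal, intervalIntegral.integral_const_mul,
    intervalIntegral.integral_const_mul, intervalIntegral.mul_integral_comp_mul_right, zero_mul]

theorem inner_ind_sineKer_comm {ρ σ : ℝ} (hρ : 0 ≤ ρ) (hσ : 0 ≤ σ) :
    inner ℂ (ind σ) (sineKer ρ) = inner ℂ (sineKer σ) (ind ρ) := by
  rw [← inner_conj_symm (sineKer σ), inner_ind_sineKer hσ, inner_ind_sineKer hρ, Complex.conj_ofReal,
    mul_comm ρ σ]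

end SineKernel

/-! ### The cosine transform as a self-adjoint unitary involution. -/

section CosineTransform

/-- Finite combinations of indicators. -/
abbrev indComb : (Ioi (0 : ℝ) →₀ ℂ) →ₗ[ℂ] HalfL2 :=
  Finsupp.linearCombination ℂ (fun ρ : Ioi (0 : ℝ) => ind ρ)

/-- Finite combinations of sine kernels. -/
abbrev sineComb : (Ioi (0 : ℝ) →₀ ℂ) →ₗ[ℂ] HalfL2 :=
  Finsupp.linearCombination ℂ (fun ρ : Ioi (0 : ℝ) => sineKer ρ)

theorem inner_sineComb (c d : Ioi (0 : ℝ) →₀ ℂ) :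
    inner ℂ (sineComb c) (sineComb d) = inner ℂ (indComb c) (indComb d) := by
  simp only [Finsupp.linearCombination_apply, Finsupp.sum, sum_inner, inner_sum, inner_smul_left,
    inner_smul_right]
  refine Finset.sum_congr rfl fun j _ => congrArg _ (Finset.sum_congr rfl fun i _ => ?_)
  rw [inner_sineKer_sineKer (le_of_lt i.2) (le_of_lt j.2),
    inner_ind_ind (le_of_lt i.2) (le_of_lt j.2)]

theorem norm_sineComb (c : Ioi (0 : ℝ) →₀ ℂ) : ‖sineComb c‖ = ‖indComb c‖ := by
  rw [@norm_eq_sqrt_re_inner ℂ, @norm_eq_sqrt_re_inner ℂ, inner_sineComb]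

/-- The cosine transform on `HalfL2`: the isometry carrying indicators to sine kernels. -/
def cosT : HalfL2 →L[ℂ] HalfL2 := sineComb.extendOfNorm indComb

theorem cosT_indComb (c : Ioi (0 : ℝ) →₀ ℂ) : cosT (indComb c) = sineComb c :=
  LinearMap.extendOfNorm_eq dense_span_ind ⟨1, fun x => by rw [one_mul, norm_sineComb]⟩ c

theorem cosT_ind {ρ : ℝ} (hρ : 0 < ρ) : cosT (ind ρ) = sineKer ρ := by
  simpa using cosT_indComb (Finsupp.single ⟨ρ, hρ⟩ 1)

theorem norm_cosT (w : HalfL2) : ‖cosT w‖ = ‖w‖ := by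
  refine dense_span_ind.induction_on (p := fun w => ‖cosT w‖ = ‖w‖) w
    (isClosed_eq (by fun_prop) (by fun_prop)) fun c => ?_
  rw [cosT_indComb, norm_sineComb]

theorem inner_cosT_left (v w : HalfL2) : inner ℂ (cosT v) w = inner ℂ v (cosT w) := by
  refine dense_span_ind.induction_on (p := fun v => inner ℂ (cosT v) w = inner ℂ v (cosT w)) v
    (isClosed_eq (by fun_prop) (by fun_prop)) fun c => ?_
  refine dense_span_ind.induction_on
    (p := fun w => inner ℂ (cosT (indComb c)) w = inner ℂ (indComb c) (cosT w)) w
    (isClosed_eq (by fun_prop) (by fun_prop)) fun d => ?_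
  rw [cosT_indComb, cosT_indComb]
  simp only [Finsupp.linearCombination_apply, Finsupp.sum, sum_inner, inner_sum, inner_smul_left,
    inner_smul_right]
  refine Finset.sum_congr rfl fun j _ => congrArg _ (Finset.sum_congr rfl fun i _ => ?_)
  rw [inner_ind_sineKer_comm (le_of_lt j.2) (le_of_lt i.2)]

theorem inner_cosT_cosT (v w : HalfL2) : inner ℂ (cosT v) (cosT w) = inner ℂ v w := by
  let L : HalfL2 →ₗᵢ[ℂ] HalfL2 := ⟨cosT.toLinearMap, norm_cosT⟩
  exact L.inner_map_map v w

/-- A self-adjoint isometry squares to the identity; no separate inversion theorem is needed. -/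
theorem cosT_cosT (w : HalfL2) : cosT (cosT w) = w := by
  refine ext_inner_left ℂ fun v => ?_
  rw [← inner_cosT_left, inner_cosT_cosT]

theorem prim_cosT {ρ : ℝ} (hρ : 0 < ρ) (w : HalfL2) :
    prim (cosT w) ρ = ∫ l in Ioi (0 : ℝ), (sineFun ρ l : ℂ) * w l := by
  rw [prim, ← inner_cosT_left, cosT_ind hρ, inner_sineKer_left]

end CosineTransform

/-! ### The free propagator as a strongly continuous unitary group. -/

section Propagator

open BoundedContinuousFunction

/-- The phase `e^{-il²t}`. -/
def phase (t : ℝ) : ℝ →ᵇ ℂ :=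
  BoundedContinuousFunction.ofNormedAddCommGroup
    (fun l : ℝ => Complex.exp (-Complex.I * (l : ℂ) ^ 2 * (t : ℂ))) (by fun_prop) 1 (fun l => by
      rw [show -Complex.I * (l : ℂ) ^ 2 * (t : ℂ) = ((-(l ^ 2 * t) : ℝ) : ℂ) * Complex.I by
        push_cast; ring, Complex.norm_exp_ofReal_mul_I])

theorem phase_apply (t l : ℝ) :
    phase t l = Complex.exp (-Complex.I * (l : ℂ) ^ 2 * (t : ℂ)) := rfl

theorem norm_phase_apply (t l : ℝ) : ‖phase t l‖ = 1 := by
  rw [phase_apply, show -Complex.I * (l : ℂ) ^ 2 * (t : ℂ) = ((-(l ^ 2 * t) : ℝ) : ℂ) * Complex.I by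
    push_cast; ring, Complex.norm_exp_ofReal_mul_I]

theorem norm_phase_le (t : ℝ) : ‖phase t‖ ≤ 1 :=
  BoundedContinuousFunction.norm_ofNormedAddCommGroup_le _ zero_le_one _

theorem phase_zero : phase 0 = 1 := by
  ext l; simp [phase_apply]

theorem phase_add (s t : ℝ) : phase (s + t) = phase s * phase t := by
  ext l
  rw [BoundedContinuousFunction.mul_apply, phase_apply, phase_apply, phase_apply, ← Complex.exp_add]
  congr 1; push_cast; ring

/-- The free propagator acting on derivatives of profiles. -/
def prop (t : ℝ) : HalfL2 →L[ℂ] HalfL2 := cosT ∘L mulBCF (phase t) ∘L cosT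

theorem prop_apply (t : ℝ) (w : HalfL2) : prop t w = cosT (mulBCF (phase t) (cosT w)) := rfl

theorem prop_zero (w : HalfL2) : prop 0 w = w := by
  rw [prop_apply, phase_zero, mulBCF_one, cosT_cosT]

theorem prop_add (s t : ℝ) (w : HalfL2) : prop (s + t) w = prop s (prop t w) := by
  rw [prop_apply, prop_apply, prop_apply, cosT_cosT, phase_add, mulBCF_mul]

theorem norm_mulBCF_phase (t : ℝ) (w : HalfL2) : ‖mulBCF (phase t) w‖ = ‖w‖ := by
  refine le_antisymm (Lp.norm_le_norm_of_ae_le ?_) (Lp.norm_le_norm_of_ae_le ?_) <;>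
  · filter_upwards [coeFn_mulBCF (phase t) w] with x hx
    rw [hx, norm_mul, norm_phase_apply, one_mul]

theorem norm_prop (t : ℝ) (w : HalfL2) : ‖prop t w‖ = ‖w‖ := by
  rw [prop_apply, norm_cosT, norm_mulBCF_phase, norm_cosT]

theorem continuous_prop_apply (w : HalfL2) : Continuous fun t => prop t w := by
  refine continuous_iff_continuousAt.2 fun t => (cosT.continuous.tendsto _).comp ?_
  refine tendsto_mulBCF (C := 1) (.of_forall norm_phase_le) (fun x _ => ?_) _
  have : Continuous fun s : ℝ => phase s x := by simp only [phase_apply]; fun_prop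
  exact this.tendsto t

theorem continuous_prop : Continuous fun p : ℝ × HalfL2 => prop p.1 p.2 := by
  refine continuous_iff_continuousAt.2 fun ⟨t, w⟩ => ?_
  have h1 : Tendsto (fun p : ℝ × HalfL2 => prop p.1 w) (𝓝 (t, w)) (𝓝 (prop t w)) :=
    ((continuous_prop_apply w).comp continuous_fst).tendsto (t, w)
  have h2 : Tendsto (fun p : ℝ × HalfL2 => prop p.1 (p.2 - w)) (𝓝 (t, w)) (𝓝 0) := by
    rw [tendsto_zero_iff_norm_tendsto_zero]
    simp_rw [norm_prop]
    have : Continuous fun p : ℝ × HalfL2 => ‖p.2 - w‖ := by fun_prop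
    simpa using this.tendsto (t, w)
  have := h1.add h2
  rw [ContinuousAt]
  simpa using this

end Propagator

/-! ### Passage from radial functions on `Ω` to derivatives of reduced profiles. -/

section Profile

/-- The radial function on `Ω` whose reduced profile `r f(r)` has derivative `w`. -/
def radial (w : HalfL2) (x : E3) : ℂ := prim w (‖x‖ - 1) / ‖x‖

/-- The kernel is split as `sin(lρ) g(l) = (sin(lρ)/l) (l g(l))`, and `l g(l)` is the
square-integrable quantity. -/
theorem sineInv_eq_radial {g : ℝ → ℂ} (hg : MemLp (fun l : ℝ => (l : ℂ) * g l) 2 volHalf) {x : E3}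
    (hx : x ∈ Omega) : sineInv g x = radial (cosT (hg.toLp _)) x := by
  have hx' : 1 < ‖x‖ := hx
  rw [radial, prim_cosT (by linarith), sineInv, ← integral_const_mul, ← integral_div]
  refine integral_congr_ae ?_
  filter_upwards [hg.coeFn_toLp, ae_restrict_mem measurableSet_Ioi] with l hl hl0
  have h0 : (l : ℂ) ≠ 0 := by exact_mod_cast (ne_of_gt (mem_Ioi.1 hl0))
  rw [hl, sineFun]
  push_cast
  field_simp

theorem eq_of_radial_eq {v w : HalfL2} (h : ∀ x ∈ Omega, radial v x = radial w x) : v = w := by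
  refine ext_prim fun ρ hρ => ?_
  obtain ⟨x, hn⟩ := exists_norm_eq E3 (show 0 ≤ 1 + ρ by linarith)
  have := h x (show 1 < ‖x‖ by linarith)
  rw [radial, radial, hn, add_sub_cancel_left] at this
  have h0 : ((1 + ρ : ℝ) : ℂ) ≠ 0 := by exact_mod_cast (by linarith : 1 + ρ ≠ 0)
  exact (div_left_inj' h0).1 this

theorem exists_isSineTransform {f : E3 → ℂ} {w : HalfL2} (h : ∀ x ∈ Omega, f x = radial w x) :
    ∃ g, IsSineTransform f g := by
  have e : (fun l : ℝ => (l : ℂ) * (cosT w l / l)) =ᵐ[volHalf] cosT w := by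
    filter_upwards [ae_restrict_mem measurableSet_Ioi] with l hl
    exact mul_div_cancel₀ _ (by exact_mod_cast (ne_of_gt (mem_Ioi.1 hl)))
  have hg : MemLp (fun l : ℝ => (l : ℂ) * (cosT w l / l)) 2 volHalf :=
    (memLp_congr_ae e).2 (halfL2_memLp _)
  refine ⟨_, hg, fun x hx => ?_⟩
  have e2 : hg.toLp _ = cosT w := Lp.ext (hg.coeFn_toLp.trans e)
  rw [sineInv_eq_radial hg hx, e2, cosT_cosT, h x hx]

/-- By injectivity of `radial`, any admissible transform `g` of `f` has `l g(l) = cosT w` almost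
everywhere, so the choice made in `sineTransform` does not matter. -/
theorem freeProp_eq_radial {f : E3 → ℂ} {w : HalfL2} (h : ∀ x ∈ Omega, f x = radial w x) (t : ℝ)
    {x : E3} (hx : x ∈ Omega) : freeProp t f x = radial (prop t w) x := by
  have hex := exists_isSineTransform h
  have hg : IsSineTransform f (sineTransform f) := by
    rw [sineTransform, dif_pos hex]; exact hex.choose_spec
  set g := sineTransform f with hgdef
  have hk : hg.1.toLp _ = cosT w := by
    rw [← cosT_cosT (hg.1.toLp _)]
    congr 1
    exact eq_of_radial_eq fun y hy => by rw [← sineInv_eq_radial hg.1 hy, ← hg.2 y hy, h y hy]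
  have e : (fun l : ℝ => (l : ℂ) * (Complex.exp (-Complex.I * (l : ℂ) ^ 2 * (t : ℂ)) * g l))
      =ᵐ[volHalf] mulBCF (phase t) (cosT w) := by
    rw [← hk]
    filter_upwards [coeFn_mulBCF (phase t) (hg.1.toLp _), hg.1.coeFn_toLp] with l h1 h2
    rw [h1, h2, phase_apply]
    ring
  have hm : MemLp (fun l : ℝ => (l : ℂ) * (Complex.exp (-Complex.I * (l : ℂ) ^ 2 * (t : ℂ)) * g l))
      2 volHalf := (memLp_congr_ae e).2 (halfL2_memLp _)
  rw [freeProp, sineInv_eq_radial hm hx, prop_apply, Lp.ext (hm.coeFn_toLp.trans e)]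

/-- Divide `norm_prim_le` by `|x|` and use `|x| - 1 ≤ |x|`. -/
theorem norm_radial_le (w : HalfL2) {x : E3} (hx : x ∈ Omega) :
    ‖radial w x‖ ≤ ‖w‖ * ‖x‖ ^ (-(1 / 2) : ℝ) := by
  have hx' : 1 < ‖x‖ := hx
  have h0 : 0 < ‖x‖ := by linarith
  rw [radial, norm_div, Complex.norm_real, Real.norm_of_nonneg h0.le, div_le_iff₀ h0, mul_assoc,
    Real.rpow_neg h0.le, ← Real.sqrt_eq_rpow]
  have h1 : (√‖x‖)⁻¹ * ‖x‖ = √‖x‖ := by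
    rw [inv_mul_eq_div, Real.div_sqrt]
  rw [h1, mul_comm]
  exact (norm_prim_le w _).trans (mul_le_mul_of_nonneg_right (Real.sqrt_le_sqrt (by linarith))
    (norm_nonneg _))

end Profile

/-! ### Hardy's inequality on the half-line. -/

section Hardy

theorem ac_normSq {f : ℝ → ℂ} {a b : ℝ} (hf : AbsolutelyContinuousOnInterval f a b) :
    AbsolutelyContinuousOnInterval (fun t => ‖f t‖ ^ 2) a b := by
  have h := ((ac_re hf).mul (ac_re hf)).add ((ac_im hf).mul (ac_im hf))
  have e : (fun t => ‖f t‖ ^ 2) =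
      ((fun t => (f t).re) * fun t => (f t).re) + (fun t => (f t).im) * fun t => (f t).im := by
    ext t
    rw [← Complex.normSq_eq_norm_sq, Complex.normSq_apply]
    rfl
  rw [e]; exact h

theorem ac_integral_real {f f' : ℝ → ℝ} {a b : ℝ} (hf : AbsolutelyContinuousOnInterval f a b)
    (h : ∀ᵐ x : ℝ, x ∈ uIcc a b → HasDerivAt f (f' x) x) :
    IntervalIntegrable f' volume a b ∧ ∫ x in a..b, f' x = f b - f a := by
  have hEq : deriv f =ᵐ[volume.restrict (uIoc a b)] f' := by
    rw [EventuallyEq, ae_restrict_iff' measurableSet_uIoc]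
    filter_upwards [h] with x hx hxm using (hx (uIoc_subset_uIcc hxm)).deriv
  exact ⟨hf.intervalIntegrable_deriv.congr_ae hEq, by
    rw [← intervalIntegral.integral_congr_ae_restrict hEq, hf.integral_deriv_eq_sub]⟩

theorem ac_inv_pow {R : ℝ} (hR : 0 ≤ R) (n : ℕ) :
    AbsolutelyContinuousOnInterval (fun ρ : ℝ => ((1 + ρ) ^ n)⁻¹) 0 R := by
  refine ContDiffOn.absolutelyContinuousOnInterval (ContDiffOn.inv (by fun_prop) fun x hx => ?_)
  rw [uIcc_of_le hR] at hx
  have := hx.1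
  positivity

theorem hasDerivAt_inv_pow {x : ℝ} (hx : 0 ≤ x) (n : ℕ) :
    HasDerivAt (fun ρ : ℝ => ((1 + ρ) ^ n)⁻¹) (-(n * ((1 + x) ^ (n + 1))⁻¹)) x := by
  have h0 : (1 + x) ≠ 0 := by positivity
  have h := (((hasDerivAt_id x).const_add 1).pow n).inv (pow_ne_zero n h0)
  refine h.congr_deriv ?_
  rcases n with _ | n
  · simp
  · simp only [id, Nat.add_sub_cancel, Pi.pow_apply]
    field_simp
    ring

/-- Integrate the derivative of `|V|²/(1 + ρ)`: the boundary term vanishes at `0` and is nonnegative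
at `R`, and the cross term is absorbed by Young's inequality. -/
theorem hardy_interval (w : HalfL2) {R : ℝ} (hR : 0 ≤ R) :
    IntervalIntegrable (fun ρ => ‖prim w ρ / (1 + ρ)‖ ^ 2) volume 0 R ∧
      ∫ ρ in (0 : ℝ)..R, ‖prim w ρ / (1 + ρ)‖ ^ 2 ≤ 4 * ‖w‖ ^ 2 := by
  have hac := (ac_normSq (prim_ac w hR)).fun_mul (ac_inv_pow hR 1)
  have hderiv : ∀ᵐ x : ℝ, x ∈ uIcc 0 R →
      HasDerivAt (fun ρ => ‖prim w ρ‖ ^ 2 * ((1 + ρ) ^ 1)⁻¹)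
        (2 * inner ℝ (prim w x) (w x) * ((1 + x) ^ 1)⁻¹ +
          ‖prim w x‖ ^ 2 * (-((1 : ℕ) * ((1 + x) ^ (1 + 1))⁻¹))) x := by
    filter_upwards [prim_ae_hasDerivAt w hR] with x hx hm
    have h0 : 0 ≤ x := by rw [uIcc_of_le hR] at hm; exact hm.1
    exact (hx hm).norm_sq.mul (hasDerivAt_inv_pow h0 1)
  obtain ⟨hi, he⟩ := ac_integral_real hac hderiv
  have hcont : ContinuousOn (fun ρ => ‖prim w ρ / (1 + ρ)‖ ^ 2) (uIcc 0 R) := by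
    have h1 : Continuous (prim w) := continuous_prim w
    refine ((h1.continuousOn.div (by fun_prop) fun x hx => ?_).norm).pow 2
    rw [uIcc_of_le hR] at hx
    have := hx.1
    exact_mod_cast (by positivity : 1 + x ≠ 0)
  have hia : IntervalIntegrable (fun ρ => ‖prim w ρ / (1 + ρ)‖ ^ 2) volume 0 R :=
    hcont.intervalIntegrable
  have hiw : IntervalIntegrable (fun ρ => ‖w ρ‖ ^ 2) volume 0 R := by
    rw [intervalIntegrable_iff, uIoc_of_le hR]
    exact (integrable_norm_sq w).mono_set Ioc_subset_Ioi_self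
  refine ⟨hia, ?_⟩
  have hle : ∫ x in (0 : ℝ)..R, (2 * inner ℝ (prim w x) (w x) * ((1 + x) ^ 1)⁻¹ +
      ‖prim w x‖ ^ 2 * (-((1 : ℕ) * ((1 + x) ^ (1 + 1))⁻¹))) ≤
      ∫ x in (0 : ℝ)..R, (2 * ‖w x‖ ^ 2 - 1 / 2 * ‖prim w x / (1 + x)‖ ^ 2) := by
    refine intervalIntegral.integral_mono_on hR hi ((hiw.const_mul 2).sub (hia.const_mul (1 / 2)))
      fun x hx => ?_
    have hx0 : 0 < 1 + x := by linarith [hx.1]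
    have hn : ‖prim w x / (1 + x)‖ = ‖prim w x‖ / (1 + x) := by
      rw [norm_div]; congr 1
      rw [← Complex.ofReal_one, ← Complex.ofReal_add, Complex.norm_real, Real.norm_of_nonneg hx0.le]
    have hin : inner ℝ (prim w x) (w x) ≤ ‖prim w x‖ * ‖w x‖ := real_inner_le_norm _ _
    rw [hn]
    set p := ‖prim w x‖ / (1 + x) with hp
    have e1 : 2 * inner ℝ (prim w x) (w x) * ((1 + x) ^ 1)⁻¹ ≤ 2 * p * ‖w x‖ := by
      rw [pow_one, ← div_eq_mul_inv, div_le_iff₀ hx0, hp]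
      calc _ ≤ 2 * (‖prim w x‖ * ‖w x‖) := by linarith
        _ = _ := by field_simp
    have e2 : ‖prim w x‖ ^ 2 * (-((1 : ℕ) * ((1 + x) ^ (1 + 1))⁻¹)) = -p ^ 2 := by
      rw [hp]; push_cast; field_simp
    rw [e2]
    -- Young's inequality `2p‖w‖ ≤ p²/2 + 2‖w‖²`.
    nlinarith [sq_nonneg (p - 2 * ‖w x‖)]
  rw [he, intervalIntegral.integral_sub (hiw.const_mul 2) (hia.const_mul (1 / 2)),
    intervalIntegral.integral_const_mul, intervalIntegral.integral_const_mul] at hle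
  have hp0 : prim w 0 = 0 := by rw [prim, ind_of_nonpos le_rfl, inner_zero_left]
  have hpos : 0 ≤ ‖prim w R‖ ^ 2 * ((1 + R) ^ 1)⁻¹ := by positivity
  have hz : ‖prim w 0‖ ^ 2 * ((1 + (0 : ℝ)) ^ 1)⁻¹ = 0 := by simp [hp0]
  have hw : ∫ x in (0 : ℝ)..R, ‖w x‖ ^ 2 ≤ ‖w‖ ^ 2 := by
    rw [norm_sq_eq_integral, intervalIntegral.integral_of_le hR]
    exact setIntegral_mono_set (integrable_norm_sq w) (.of_forall fun x => by positivity)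
      (Ioc_subset_Ioi_self.eventuallyLE)
  linarith

theorem hardy_halfLine (w : HalfL2) :
    IntegrableOn (fun ρ => ‖prim w ρ / (1 + ρ)‖ ^ 2) (Ioi 0) ∧
      ∫ ρ in Ioi (0 : ℝ), ‖prim w ρ / (1 + ρ)‖ ^ 2 ≤ 4 * ‖w‖ ^ 2 := by
  have hint : IntegrableOn (fun ρ => ‖prim w ρ / (1 + ρ)‖ ^ 2) (Ioi 0) := by
    refine integrableOn_Ioi_of_intervalIntegral_norm_bounded (4 * ‖w‖ ^ 2) 0
      (l := atTop) (b := fun n : ℕ => (n : ℝ)) (fun n => ?_) tendsto_natCast_atTop_atTop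
      (.of_forall fun n => ?_)
    · have := (hardy_interval w (Nat.cast_nonneg n)).1
      rwa [intervalIntegrable_iff_integrableOn_Ioc_of_le (Nat.cast_nonneg n)] at this
    · simpa using (hardy_interval w (Nat.cast_nonneg n)).2
  refine ⟨hint, ?_⟩
  exact le_of_tendsto (intervalIntegral_tendsto_integral_Ioi 0 hint tendsto_natCast_atTop_atTop)
    (.of_forall fun n : ℕ => (hardy_interval w (Nat.cast_nonneg n)).2)

theorem one_add_ne_zero {ρ : ℝ} (h : 0 ≤ ρ) : (1 + ρ : ℂ) ≠ 0 := by
  exact_mod_cast (by positivity : 1 + ρ ≠ 0)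

theorem memLp_hardy (w : HalfL2) : MemLp (fun ρ : ℝ => prim w ρ / (1 + ρ)) 2 volHalf := by
  refine (memLp_two_iff_integrable_sq_norm ?_).2 (hardy_halfLine w).1
  have := (continuous_prim w).measurable
  exact (show Measurable _ by fun_prop).aestronglyMeasurable

/-- The Hardy operator `w ↦ (1 + ρ)⁻¹ ∫₀^ρ w`. -/
def hardy : HalfL2 →L[ℂ] HalfL2 :=
  LinearMap.mkContinuous
    { toFun := fun w => (memLp_hardy w).toLp _
      map_add' := fun v w => by
        rw [← MemLp.toLp_add]; congr 1; ext x; simp [prim_add, add_div]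
      map_smul' := fun c w => by
        rw [RingHom.id_apply, ← MemLp.toLp_const_smul]; congr 1; ext x
        simp [prim_smul, mul_div_assoc] }
    2 (fun w => by
      have h : ‖(memLp_hardy w).toLp _‖ ^ 2 ≤ (2 * ‖w‖) ^ 2 := by
        rw [norm_sq_eq_integral, mul_pow]
        have e : ∫ x in Ioi (0 : ℝ), ‖(memLp_hardy w).toLp _ x‖ ^ 2 =
            ∫ ρ in Ioi (0 : ℝ), ‖prim w ρ / (1 + ρ)‖ ^ 2 := by
          refine integral_congr_ae ?_
          filter_upwards [(memLp_hardy w).coeFn_toLp] with x hx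
          rw [hx]
        rw [e]
        linarith [(hardy_halfLine w).2]
      exact le_of_sq_le_sq h (by positivity))

theorem coeFn_hardy (w : HalfL2) : hardy w =ᵐ[volHalf] fun ρ : ℝ => prim w ρ / (1 + ρ) :=
  (memLp_hardy w).coeFn_toLp

theorem norm_hardy_le (w : HalfL2) : ‖hardy w‖ ≤ 2 * ‖w‖ :=
  hardy.le_of_opNorm_le (LinearMap.mkContinuous_norm_le _ zero_le_two _) w

end Hardy

/-! ### The quintic nonlinearity as a continuous map of `L²(0,∞)`. -/

section Nonlinearity

open BoundedContinuousFunction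

theorem one_le_sqrt (ρ : ℝ) : 1 ≤ √(1 + |ρ|) := by
  rw [Real.one_le_sqrt]; linarith [abs_nonneg ρ]

theorem sqrt_one_add_abs_ne_zero (ρ : ℝ) : (√(1 + |ρ|) : ℂ) ≠ 0 := by
  exact_mod_cast (by linarith [one_le_sqrt ρ] : √(1 + |ρ|) ≠ 0)

/-- The weight `(1 + |ρ|)^{-1/2}`. -/
def decay : ℝ →ᵇ ℂ :=
  BoundedContinuousFunction.ofNormedAddCommGroup (fun ρ : ℝ => 1 / (√(1 + |ρ|) : ℂ))
    (Continuous.div continuous_const (by fun_prop) sqrt_one_add_abs_ne_zero) 1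
    (fun ρ => by
      rw [norm_div, norm_one, Complex.norm_real, Real.norm_of_nonneg (by positivity)]
      exact div_le_one_of_le₀ (one_le_sqrt ρ) (by positivity))

theorem norm_prim_div_le (w : HalfL2) (ρ : ℝ) : ‖prim w ρ / (√(1 + |ρ|) : ℂ)‖ ≤ ‖w‖ := by
  rw [norm_div, Complex.norm_real, Real.norm_of_nonneg (by positivity),
    div_le_iff₀ (by linarith [one_le_sqrt ρ]), mul_comm]
  refine (norm_prim_le w ρ).trans (mul_le_mul_of_nonneg_right (Real.sqrt_le_sqrt ?_) (norm_nonneg _))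
  linarith [le_abs_self ρ]

/-- The bounded function `(1 + |ρ|)^{-1/2} ∫₀^ρ w`. -/
def weighted : HalfL2 →L[ℂ] (ℝ →ᵇ ℂ) :=
  LinearMap.mkContinuous
    { toFun := fun w => BoundedContinuousFunction.ofNormedAddCommGroup
        (fun ρ : ℝ => prim w ρ / (√(1 + |ρ|) : ℂ))
        (Continuous.div (continuous_prim w) (by fun_prop) sqrt_one_add_abs_ne_zero) ‖w‖
        (norm_prim_div_le w)
      map_add' := fun v w => by ext x; simp [prim_add, add_div]
      map_smul' := fun c w => by ext x; simp [prim_smul, mul_div_assoc] }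
    1 (fun w => by
      rw [one_mul]
      exact BoundedContinuousFunction.norm_ofNormedAddCommGroup_le _ (norm_nonneg _)
        (norm_prim_div_le w))

theorem weighted_apply (w : HalfL2) (ρ : ℝ) : weighted w ρ = prim w ρ / (√(1 + |ρ|) : ℂ) := rfl

theorem decay_mul_weighted_apply (w : HalfL2) {ρ : ℝ} (hρ : 0 ≤ ρ) :
    (decay * weighted w) ρ = prim w ρ / (1 + ρ) := by
  have h : (√(1 + |ρ|) : ℂ) * (√(1 + |ρ|) : ℂ) = 1 + ρ := by
    rw [← Complex.ofReal_mul, Real.mul_self_sqrt (by positivity), abs_of_nonneg hρ]; simp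
  rw [BoundedContinuousFunction.mul_apply, weighted_apply, ← h]
  change 1 / (√(1 + |ρ|) : ℂ) * _ = _
  have := sqrt_one_add_abs_ne_zero ρ
  field_simp

/-- Pointwise complex conjugation. -/
def conjL : HalfL2 →L[ℝ] HalfL2 := (Complex.conjCLE : ℂ →L[ℝ] ℂ).compLpL 2 volHalf

theorem coeFn_conjL (w : HalfL2) : conjL w =ᵐ[volHalf] fun ρ => conj (w ρ) :=
  (Complex.conjCLE : ℂ →L[ℝ] ℂ).coeFn_compLpL w

/-- The quintic nonlinearity in terms of derivatives of reduced profiles. -/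
def quintic (w : HalfL2) : HalfL2 :=
  mulBCF ((3 : ℂ) • ((decay * weighted w) ^ 2 * star (decay * weighted w) ^ 2)) w +
    mulBCF ((2 : ℂ) • ((decay * weighted w) ^ 3 * star (decay * weighted w))) (conjL w) -
    mulBCF ((4 : ℂ) • ((decay * weighted w) ^ 2 * star (decay * weighted w) ^ 2)) (hardy w)

theorem continuous_quintic : Continuous quintic := by
  unfold quintic
  fun_prop

/-- The weighted quintic power that represents the derivative of the potential energy through the
Hardy operator. -/
def potForce (w : HalfL2) : HalfL2 := mulBCF (weighted w ^ 2 * star (weighted w) ^ 2) (hardy w)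

theorem continuous_potForce : Continuous potForce := by
  unfold potForce
  fun_prop

/-- With `v = V/(1 + ρ)`, this is the product rule for `V³ V̄² (1 + ρ)⁻⁴`, grouped so that each term
is a bounded continuous function times one of the `L²` functions `w`, `w̄`, `v`. -/
theorem coeFn_quintic (w : HalfL2) : quintic w =ᵐ[volHalf] fun ρ =>
    3 * ((prim w ρ / (1 + ρ)) ^ 2 * conj (prim w ρ / (1 + ρ)) ^ 2) * w ρ +
      2 * ((prim w ρ / (1 + ρ)) ^ 3 * conj (prim w ρ / (1 + ρ))) * conj (w ρ) -
      4 * ((prim w ρ / (1 + ρ)) ^ 2 * conj (prim w ρ / (1 + ρ)) ^ 2) * (prim w ρ / (1 + ρ)) := by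
  set φ := (3 : ℂ) • ((decay * weighted w) ^ 2 * star (decay * weighted w) ^ 2) with hφ
  set ψ := (2 : ℂ) • ((decay * weighted w) ^ 3 * star (decay * weighted w)) with hψ
  set χ := (4 : ℂ) • ((decay * weighted w) ^ 2 * star (decay * weighted w) ^ 2) with hχ
  have e : quintic w = mulBCF φ w + mulBCF ψ (conjL w) - mulBCF χ (hardy w) := rfl
  rw [e]
  filter_upwards [Lp.coeFn_sub (mulBCF φ w + mulBCF ψ (conjL w)) (mulBCF χ (hardy w)),
    Lp.coeFn_add (mulBCF φ w) (mulBCF ψ (conjL w)), coeFn_mulBCF φ w,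
    coeFn_mulBCF ψ (conjL w), coeFn_mulBCF χ (hardy w), coeFn_conjL w, coeFn_hardy w,
    ae_restrict_mem measurableSet_Ioi] with ρ h1 h2 h3 h4 h5 h6 h7 h8
  rw [h1, Pi.sub_apply, h2, Pi.add_apply, h3, h4, h5, h6, h7, ← decay_mul_weighted_apply w h8.out.le]
  rfl

/-- The reduced profile `|V|⁴V / (1 + ρ)⁴` of the nonlinearity. -/
def force (w : HalfL2) (ρ : ℝ) : ℂ := ((‖prim w ρ‖ ^ 4 : ℝ) : ℂ) * prim w ρ / (1 + ρ) ^ 4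

theorem force_eq (w : HalfL2) (ρ : ℝ) :
    force w ρ = prim w ρ ^ 3 * conj (prim w ρ) ^ 2 * ((((1 + ρ) ^ 4)⁻¹ : ℝ) : ℂ) := by
  have h : ((‖prim w ρ‖ ^ 4 : ℝ) : ℂ) = (prim w ρ * conj (prim w ρ)) ^ 2 := by
    rw [Complex.mul_conj, Complex.normSq_eq_norm_sq]; push_cast; ring
  rw [force, h]; push_cast; ring

theorem prim_zero_right (w : HalfL2) : prim w 0 = 0 := by
  rw [prim, ind_of_nonpos le_rfl, inner_zero_left]

theorem force_ac (w : HalfL2) {R : ℝ} (hR : 0 ≤ R) :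
    AbsolutelyContinuousOnInterval (force w) 0 R := by
  have hV := prim_ac w hR
  have hC := ac_conj hV
  have := (((hV.smul hV).smul hV).smul (hC.smul hC)).smul (ac_ofReal (ac_inv_pow hR 4))
  have e : force w = (((prim w • prim w) • prim w) • (fun t => conj (prim w t)) • fun t =>
      conj (prim w t)) • fun t : ℝ => ((((1 + t) ^ 4)⁻¹ : ℝ) : ℂ) := by
    funext ρ
    change force w ρ = prim w ρ * prim w ρ * prim w ρ * (conj (prim w ρ) * conj (prim w ρ)) *
      ((((1 + ρ) ^ 4)⁻¹ : ℝ) : ℂ)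
    rw [force_eq]
    ring
  rw [e]
  exact this

theorem force_ae_hasDerivAt (w : HalfL2) {R : ℝ} (hR : 0 ≤ R) :
    ∀ᵐ x : ℝ, x ∈ uIcc 0 R → HasDerivAt (force w) (quintic w x) x := by
  have hq := coeFn_quintic w
  rw [EventuallyEq, ae_restrict_iff' measurableSet_Ioi] at hq
  filter_upwards [prim_ae_hasDerivAt w hR, hq,
    compl_mem_ae_iff.2 (measure_singleton (0 : ℝ))] with x hx hq h0 hm
  have hx0 : 0 < x := by
    rw [uIcc_of_le hR] at hm
    exact lt_of_le_of_ne hm.1 (Ne.symm h0)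
  have hV := hx hm
  have hC : HasDerivAt (fun ρ => conj (prim w ρ)) (conj (w x)) x :=
    Complex.conjCLE.hasFDerivAt.comp_hasDerivAt x hV
  have hI := (hasDerivAt_inv_pow hx0.le 4).ofReal_comp
  have h := (((hV.pow 3).mul (hC.pow 2)).mul hI)
  have he : force w = ((prim w) ^ 3 * (fun ρ => conj (prim w ρ)) ^ 2) *
      fun ρ : ℝ => ((((1 + ρ) ^ 4)⁻¹ : ℝ) : ℂ) := by
    ext ρ; rw [force_eq]; rfl
  rw [he]
  refine h.congr_deriv ?_
  rw [hq hx0]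
  have h1 := one_add_ne_zero hx0.le
  have h2 : conj (1 + x : ℂ) = 1 + x := by simp
  simp only [Pi.mul_apply, Pi.pow_apply, map_div₀, h2]
  push_cast
  field_simp
  ring

/-- `quintic w` is the a.e. derivative of `force w`, which is absolutely continuous and vanishes at
`0`. -/
theorem prim_quintic (w : HalfL2) {ρ : ℝ} (hρ : 0 ≤ ρ) : prim (quintic w) ρ = force w ρ := by
  rw [prim_eq_integral _ hρ, (ac_integral (force_ac w hρ) (force_ae_hasDerivAt w hρ)).2]
  simp [force, prim_zero_right]

theorem nonlin_radial {f : E3 → ℂ} {w : HalfL2} (h : ∀ x ∈ Omega, f x = radial w x) :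
    ∀ x ∈ Omega, nonlin f x = radial (quintic w) x := by
  intro x hx
  have hx' : 1 < ‖x‖ := hx
  have h0 : (‖x‖ : ℂ) ≠ 0 := by exact_mod_cast (by linarith : ‖x‖ ≠ 0)
  rw [nonlin, h x hx, radial, radial, prim_quintic w (by linarith), force, norm_div,
    Complex.norm_real, norm_norm]
  push_cast
  rw [add_sub_cancel]
  field_simp

end Nonlinearity

/-! ### The potential energy, its gradient and its Taylor expansion. -/

section PotentialEnergy

open BoundedContinuousFunction

theorem coeFn_potForce (w : HalfL2) : potForce w =ᵐ[volHalf] fun ρ : ℝ =>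
    force w ρ * (1 + ρ) := by
  have e : potForce w = mulBCF (weighted w ^ 2 * star (weighted w) ^ 2) (hardy w) := rfl
  rw [e]
  filter_upwards [coeFn_mulBCF (weighted w ^ 2 * star (weighted w) ^ 2) (hardy w), coeFn_hardy w,
    ae_restrict_mem measurableSet_Ioi] with ρ h1 h2 h3
  have h0 : (0 : ℝ) < ρ := h3
  have hs : (√(1 + |ρ|) : ℂ) ^ 2 = 1 + ρ := by
    rw [← Complex.ofReal_pow, Real.sq_sqrt (by positivity), abs_of_pos h0]; simp
  have hc : (weighted w ^ 2 * star (weighted w) ^ 2) ρ =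
      prim w ρ ^ 2 * conj (prim w ρ) ^ 2 / (1 + ρ) ^ 2 := by
    change (prim w ρ / (√(1 + |ρ|) : ℂ)) ^ 2 * conj (prim w ρ / (√(1 + |ρ|) : ℂ)) ^ 2 = _
    rw [map_div₀, Complex.conj_ofReal, div_pow, div_pow, hs]
    have := one_add_ne_zero h0.le
    field_simp
  rw [h1, h2, hc, force_eq]
  have := one_add_ne_zero h0.le
  push_cast
  field_simp

/-- The gradient of the potential energy on `HalfL2`. -/
def potGrad (w : HalfL2) : HalfL2 := ContinuousLinearMap.adjoint hardy (potForce w)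

theorem continuous_potGrad : Continuous potGrad := by
  unfold potGrad
  have := continuous_potForce
  fun_prop

/-- The weight `1 + ρ` is moved from `V` to the force, so that both factors are square-integrable
and the pairing is a bounded functional of `w`. -/
theorem inner_potForce_ae (v w : HalfL2) :
    (fun ρ => inner ℂ (potForce v ρ) (hardy w ρ)) =ᵐ[volHalf]
      fun ρ => conj (force v ρ) * prim w ρ := by
  filter_upwards [coeFn_potForce v, coeFn_hardy w, ae_restrict_mem measurableSet_Ioi]
    with ρ h1 h2 h3
  have := one_add_ne_zero (le_of_lt (mem_Ioi.1 h3))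
  rw [h1, h2, RCLike.inner_apply, map_mul]
  have hc : conj (1 + ρ : ℂ) = 1 + ρ := by simp
  rw [hc]
  field_simp

theorem integrable_force_mul_prim (v w : HalfL2) :
    IntegrableOn (fun ρ => conj (force v ρ) * prim w ρ) (Ioi 0) :=
  (L2.integrable_inner (𝕜 := ℂ) (potForce v) (hardy w)).congr (inner_potForce_ae v w)

theorem inner_potGrad (v w : HalfL2) :
    inner ℂ (potGrad v) w = ∫ ρ in Ioi (0 : ℝ), conj (force v ρ) * prim w ρ := by
  rw [potGrad, ContinuousLinearMap.adjoint_inner_left, L2.inner_def]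
  exact integral_congr_ae (inner_potForce_ae v w)

/-- The potential energy. -/
def potential (w : HalfL2) : ℝ := (1 / 6) * (inner ℂ (potGrad w) w).re

theorem re_force_mul_prim (w : HalfL2) (ρ : ℝ) (h : 0 < ρ) :
    (conj (force w ρ) * prim w ρ).re = ‖prim w ρ‖ ^ 6 / (1 + ρ) ^ 4 := by
  rw [force_eq]
  have : conj (prim w ρ ^ 3 * conj (prim w ρ) ^ 2 * ((((1 + ρ) ^ 4)⁻¹ : ℝ) : ℂ)) * prim w ρ =
      (((‖prim w ρ‖ ^ 2) ^ 3 * ((1 + ρ) ^ 4)⁻¹ : ℝ) : ℂ) := by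
    rw [map_mul, Complex.conj_ofReal, map_mul, map_pow, map_pow, Complex.conj_conj,
      ← Complex.normSq_eq_norm_sq]
    push_cast
    rw [← Complex.mul_conj]
    ring
  rw [this, Complex.ofReal_re]
  field_simp

theorem potential_nonneg (w : HalfL2) : 0 ≤ potential w := by
  rw [potential, inner_potGrad, ← RCLike.re_eq_complex_re, ← integral_re (integrable_force_mul_prim w w)]
  refine mul_nonneg (by norm_num) (setIntegral_nonneg measurableSet_Ioi fun ρ hρ => ?_)
  rw [RCLike.re_eq_complex_re, re_force_mul_prim w ρ hρ]
  have := mem_Ioi.1 hρ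
  positivity

theorem norm_potForce_le (w : HalfL2) : ‖potForce w‖ ≤ 2 * ‖w‖ ^ 5 := by
  refine (norm_mulBCF_le _ _).trans ?_
  have hw : ‖weighted w‖ ≤ ‖w‖ := by
    simpa using weighted.le_of_opNorm_le (LinearMap.mkContinuous_norm_le _ zero_le_one _) w
  have h : ‖weighted w ^ 2 * star (weighted w) ^ 2‖ ≤ ‖w‖ ^ 4 :=
    calc _ ≤ ‖weighted w‖ ^ 2 * ‖star (weighted w)‖ ^ 2 :=
          (norm_mul_le _ _).trans (mul_le_mul (norm_pow_le _ _) (norm_pow_le _ _) (by positivity)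
            (by positivity))
      _ = ‖weighted w‖ ^ 4 := by rw [norm_star]; ring
      _ ≤ _ := pow_le_pow_left₀ (norm_nonneg _) hw 4
  calc _ ≤ ‖w‖ ^ 4 * (2 * ‖w‖) := mul_le_mul h (norm_hardy_le w) (by positivity) (by positivity)
    _ = _ := by ring

theorem potential_le (w : HalfL2) : potential w ≤ ‖w‖ ^ 6 := by
  have h : (inner ℂ (potGrad w) w).re ≤ (2 * ‖w‖ ^ 5) * (2 * ‖w‖) := by
    rw [potGrad, ContinuousLinearMap.adjoint_inner_left]
    refine (Complex.re_le_norm _).trans ((norm_inner_le_norm _ _).trans ?_)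
    exact mul_le_mul (norm_potForce_le w) (norm_hardy_le w) (by positivity) (by positivity)
  rw [potential]
  nlinarith [pow_nonneg (norm_nonneg w) 6]

/-- With `p = Re(ā(b - a))` and `d = |b - a|`, one has `|b|² = |a|² + 2p + d²`. This turns the
remainder into a real polynomial, whose terms are bounded through `|p| ≤ |a| d` and `||b| - |a|| ≤
d`. -/
theorem pow_six_taylor (a b : ℂ) :
    |‖b‖ ^ 6 / 6 - ‖a‖ ^ 6 / 6 - (conj (((‖a‖ ^ 4 : ℝ) : ℂ) * a) * (b - a)).re| ≤
      (‖a‖ + ‖b‖) ^ 4 * ‖b - a‖ ^ 2 := by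
  set p := (conj a * (b - a)).re with hp
  set d := ‖b - a‖ with hd
  have h1 : (conj (((‖a‖ ^ 4 : ℝ) : ℂ) * a) * (b - a)).re = ‖a‖ ^ 4 * p := by
    rw [map_mul, Complex.conj_ofReal, mul_assoc, Complex.re_ofReal_mul]
  have hB : ‖b‖ ^ 2 = ‖a‖ ^ 2 + 2 * p + d ^ 2 := by
    have : b = a + (b - a) := by ring
    conv_lhs => rw [this]
    rw [← Complex.normSq_eq_norm_sq, Complex.normSq_add, Complex.normSq_eq_norm_sq,
      Complex.normSq_eq_norm_sq, hp, hd]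
    have : (a * conj (b - a)).re = (conj a * (b - a)).re := by
      rw [← Complex.conj_re (a * conj (b - a)), map_mul, Complex.conj_conj]
    rw [this]; ring
  have hpb : |p| ≤ ‖a‖ * d := by
    have := Complex.abs_re_le_norm (conj a * (b - a))
    rwa [norm_mul, Complex.norm_conj] at this
  have hdb : |‖b‖ - ‖a‖| ≤ d := abs_norm_sub_norm_le b a
  rw [h1]
  set α := ‖a‖
  set β := ‖b‖
  have hα : 0 ≤ α := norm_nonneg _
  have hβ : 0 ≤ β := norm_nonneg _
  have hd0 : 0 ≤ d := norm_nonneg _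
  have e : β ^ 6 / 6 - α ^ 6 / 6 - α ^ 4 * p =
      (d ^ 2 * (α ^ 4 + α ^ 2 * β ^ 2 + β ^ 4) +
        2 * (p * ((β - α) * ((α + β) * (β ^ 2 + 2 * α ^ 2))))) / 6 := by
    have hp' : 2 * p = β ^ 2 - α ^ 2 - d ^ 2 := by linarith
    have : p = (β ^ 2 - α ^ 2 - d ^ 2) / 2 := by linarith
    rw [this]; ring
  rw [e, abs_div, abs_of_pos (by norm_num : (0 : ℝ) < 6), div_le_iff₀ (by norm_num)]
  have h2 : |p * ((β - α) * ((α + β) * (β ^ 2 + 2 * α ^ 2)))| ≤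
      (α * d) * (d * ((α + β) * (β ^ 2 + 2 * α ^ 2))) := by
    rw [abs_mul, abs_mul, abs_of_nonneg (by positivity : 0 ≤ (α + β) * (β ^ 2 + 2 * α ^ 2))]
    gcongr
  refine (abs_add_le _ _).trans ?_
  rw [abs_of_nonneg (by positivity : 0 ≤ d ^ 2 * (α ^ 4 + α ^ 2 * β ^ 2 + β ^ 4)), abs_mul,
    abs_of_pos (by norm_num : (0 : ℝ) < 2)]
  -- Exactly the difference between `6(α + β)⁴ d²` and the two bounds just obtained.
  have h3 : 0 ≤ d ^ 2 * (α ^ 4 + 20 * α ^ 3 * β + 33 * α ^ 2 * β ^ 2 + 22 * α * β ^ 3 + 5 * β ^ 4) := by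
    positivity
  nlinarith

/-- Integrate the pointwise expansion. The fourth powers of the profiles absorb `(1 + ρ)²` by
Cauchy–Schwarz, and Hardy's inequality bounds what remains. -/
theorem potential_taylor (v w : HalfL2) :
    |potential w - potential v - (inner ℂ (potGrad v) (w - v)).re| ≤
      4 * (‖v‖ + ‖w‖) ^ 4 * ‖w - v‖ ^ 2 := by
  have hv := integrable_force_mul_prim v v
  have hw := integrable_force_mul_prim w w
  have hvw := integrable_force_mul_prim v (w - v)
  have e : potential w - potential v - (inner ℂ (potGrad v) (w - v)).re =
      ∫ ρ in Ioi (0 : ℝ), (1 / 6 * (conj (force w ρ) * prim w ρ).re -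
        1 / 6 * (conj (force v ρ) * prim v ρ).re - (conj (force v ρ) * prim (w - v) ρ).re) := by
    rw [potential, potential, inner_potGrad, inner_potGrad, inner_potGrad]
    simp only [← RCLike.re_eq_complex_re]
    rw [← integral_re hv, ← integral_re hw, ← integral_re hvw, integral_sub, integral_sub,
      integral_const_mul, integral_const_mul]
    · exact hw.re.const_mul _
    · exact hv.re.const_mul _
    · exact (hw.re.const_mul _).sub (hv.re.const_mul _)
    · exact hvw.re
  rw [e]
  have hb : ∀ ρ ∈ Ioi (0 : ℝ), ‖1 / 6 * (conj (force w ρ) * prim w ρ).re -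
      1 / 6 * (conj (force v ρ) * prim v ρ).re - (conj (force v ρ) * prim (w - v) ρ).re‖ ≤
      (‖v‖ + ‖w‖) ^ 4 * ‖prim (w - v) ρ / (1 + ρ)‖ ^ 2 := by
    intro ρ hρ
    have h0 : 0 < ρ := hρ
    have h1 : (0 : ℝ) < 1 + ρ := by linarith
    have hf : (conj (force v ρ) * prim (w - v) ρ).re =
        (conj (((‖prim v ρ‖ ^ 4 : ℝ) : ℂ) * prim v ρ) * (prim w ρ - prim v ρ)).re / (1 + ρ) ^ 4 := by
      rw [← Complex.div_ofReal_re, prim_sub, force]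
      congr 1
      rw [map_div₀, map_pow]
      have : conj (1 + ρ : ℂ) = 1 + ρ := by simp
      rw [this]
      push_cast
      ring
    have hn : ‖prim (w - v) ρ / (1 + ρ)‖ = ‖prim w ρ - prim v ρ‖ / (1 + ρ) := by
      rw [prim_sub, norm_div]; congr 1
      rw [← Complex.ofReal_one, ← Complex.ofReal_add, Complex.norm_real, Real.norm_of_nonneg h1.le]
    rw [re_force_mul_prim w ρ h0, re_force_mul_prim v ρ h0, hf, hn]
    have ht := pow_six_taylor (prim v ρ) (prim w ρ)
    have hs : ∀ z : HalfL2, ‖prim z ρ‖ ≤ √(1 + ρ) * ‖z‖ := fun z =>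
      (norm_prim_le z ρ).trans (mul_le_mul_of_nonneg_right (Real.sqrt_le_sqrt (by linarith))
        (norm_nonneg _))
    have h4 : (‖prim v ρ‖ + ‖prim w ρ‖) ^ 4 ≤ (1 + ρ) ^ 2 * (‖v‖ + ‖w‖) ^ 4 := by
      calc _ ≤ (√(1 + ρ) * (‖v‖ + ‖w‖)) ^ 4 :=
            pow_le_pow_left₀ (by positivity) (by linarith [hs v, hs w]) 4
        _ = (√(1 + ρ) ^ 2) ^ 2 * (‖v‖ + ‖w‖) ^ 4 := by ring
        _ = _ := by rw [Real.sq_sqrt h1.le]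
    have e2 : 1 / 6 * (‖prim w ρ‖ ^ 6 / (1 + ρ) ^ 4) - 1 / 6 * (‖prim v ρ‖ ^ 6 / (1 + ρ) ^ 4) -
        (conj (((‖prim v ρ‖ ^ 4 : ℝ) : ℂ) * prim v ρ) * (prim w ρ - prim v ρ)).re / (1 + ρ) ^ 4 =
        (‖prim w ρ‖ ^ 6 / 6 - ‖prim v ρ‖ ^ 6 / 6 -
        (conj (((‖prim v ρ‖ ^ 4 : ℝ) : ℂ) * prim v ρ) * (prim w ρ - prim v ρ)).re) /
          (1 + ρ) ^ 4 := by ring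
    rw [e2, Real.norm_eq_abs, abs_div, abs_of_pos (by positivity : 0 < (1 + ρ) ^ 4),
      div_le_iff₀ (by positivity)]
    refine ht.trans ?_
    calc _ ≤ (1 + ρ) ^ 2 * (‖v‖ + ‖w‖) ^ 4 * ‖prim w ρ - prim v ρ‖ ^ 2 := by gcongr
      _ = _ := by field_simp
  refine (norm_integral_le_of_norm_le ((hardy_halfLine (w - v)).1.const_mul _)
    ((ae_restrict_iff' measurableSet_Ioi).2 (.of_forall hb))).trans ?_
  rw [integral_const_mul]
  have := (hardy_halfLine (w - v)).2
  calc _ ≤ (‖v‖ + ‖w‖) ^ 4 * (4 * ‖w - v‖ ^ 2) := by gcongr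
    _ = _ := by ring

theorem hasDerivAt_potential_segment (w h : HalfL2) (s : ℝ) :
    HasDerivAt (fun s : ℝ => potential (w + (s : ℂ) • h)) (inner ℂ (potGrad (w + (s : ℂ) • h)) h).re s := by
  rw [hasDerivAt_iff_isLittleO]
  refine Asymptotics.IsBigO.trans_isLittleO ?_ (Asymptotics.isLittleO_pow_sub_sub s one_lt_two)
  have hc : Continuous fun s' : ℝ => 4 * (‖w + (s : ℂ) • h‖ + ‖w + (s' : ℂ) • h‖) ^ 4 * ‖h‖ ^ 2 := by
    fun_prop
  refine Asymptotics.IsBigO.of_bound (4 * (‖w + (s : ℂ) • h‖ + ‖w + (s : ℂ) • h‖) ^ 4 * ‖h‖ ^ 2 + 1) ?_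
  filter_upwards [(hc.tendsto s).eventually (gt_mem_nhds (lt_add_one _))] with s' hs'
  have ht := potential_taylor (w + (s : ℂ) • h) (w + (s' : ℂ) • h)
  have e : w + (s' : ℂ) • h - (w + (s : ℂ) • h) = ((s' - s : ℝ) : ℂ) • h := by
    rw [add_sub_add_left_eq_sub, ← sub_smul]; push_cast; rfl
  rw [e, inner_smul_right, Complex.re_ofReal_mul, norm_smul, Complex.norm_real, mul_pow] at ht
  rw [smul_eq_mul, Real.norm_eq_abs, norm_pow, norm_norm]
  refine ht.trans ?_
  calc _ = 4 * (‖w + (s : ℂ) • h‖ + ‖w + (s' : ℂ) • h‖) ^ 4 * ‖h‖ ^ 2 * ‖s' - s‖ ^ 2 := by ring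
    _ ≤ _ := by gcongr

/-- A mean value form without remainder is what conservation needs: along the flow the quadratic
remainder `‖w t - w t₀‖²` is not known to be `o(t - t₀)`. -/
theorem exists_potential_sub (w h : HalfL2) : ∃ s ∈ Ioo (0 : ℝ) 1,
    potential (w + h) - potential w = (inner ℂ (potGrad (w + (s : ℂ) • h)) h).re := by
  obtain ⟨s, hs, he⟩ := exists_hasDerivAt_eq_slope (fun s : ℝ => potential (w + (s : ℂ) • h))
    (fun s => (inner ℂ (potGrad (w + (s : ℂ) • h)) h).re) zero_lt_one
    (fun s _ => (hasDerivAt_potential_segment w h s).continuousAt.continuousWithinAt)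
    (fun s _ => hasDerivAt_potential_segment w h s)
  refine ⟨s, hs, ?_⟩
  rw [he]
  simp

end PotentialEnergy

/-! ### The gradient of the potential is the inverse Laplacian of the nonlinearity. -/

section Elliptic

theorem norm_force_le (w : HalfL2) {ρ : ℝ} (hρ : 0 ≤ ρ) : ‖force w ρ‖ ≤ ‖w‖ ^ 5 := by
  have h1 : (1 : ℝ) ≤ 1 + ρ := by linarith
  have hV : ‖prim w ρ‖ ≤ √(1 + ρ) * ‖w‖ :=
    (norm_prim_le w ρ).trans (mul_le_mul_of_nonneg_right (Real.sqrt_le_sqrt (by linarith))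
      (norm_nonneg _))
  have hn : ‖force w ρ‖ = ‖prim w ρ‖ ^ 5 / (1 + ρ) ^ 4 := by
    rw [force, norm_div, norm_mul, Complex.norm_real, norm_pow, norm_pow, norm_norm,
      ← Complex.ofReal_one, ← Complex.ofReal_add, Complex.norm_real,
      Real.norm_of_nonneg (by linarith : 0 ≤ 1 + ρ)]
    ring
  rw [hn, div_le_iff₀ (by positivity)]
  have hs : √(1 + ρ) ≤ 1 + ρ := by
    rw [Real.sqrt_le_left (by linarith)]; nlinarith
  calc _ ≤ (√(1 + ρ) * ‖w‖) ^ 5 := pow_le_pow_left₀ (norm_nonneg _) hV 5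
    _ = ‖w‖ ^ 5 * ((√(1 + ρ) ^ 2) ^ 2 * √(1 + ρ)) := by ring
    _ = ‖w‖ ^ 5 * ((1 + ρ) ^ 2 * √(1 + ρ)) := by rw [Real.sq_sqrt (by linarith)]
    _ ≤ ‖w‖ ^ 5 * ((1 + ρ) ^ 2 * (1 + ρ)) := by gcongr
    _ ≤ ‖w‖ ^ 5 * (1 + ρ) ^ 4 := by
      gcongr
      calc (1 + ρ) ^ 2 * (1 + ρ) = (1 + ρ) ^ 3 := by ring
        _ ≤ (1 + ρ) ^ 4 := pow_le_pow_right₀ h1 (by norm_num)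

theorem memLp_sq_indicator (σ : ℝ) :
    MemLp ((Ioc 0 σ).indicator fun l : ℝ => ((l ^ 2 : ℝ) : ℂ)) 2 volHalf := by
  rw [memLp_indicator_iff_restrict measurableSet_Ioc, restrict_volHalf_Ioc]
  have : IsFiniteMeasure (volume.restrict (Ioc 0 σ)) := ⟨by simp [Real.volume_Ioc]⟩
  refine MemLp.of_bound (by fun_prop) (σ ^ 2) ?_
  filter_upwards [ae_restrict_mem measurableSet_Ioc] with l hl
  rw [Complex.norm_real, Real.norm_of_nonneg (by positivity)]
  exact pow_le_pow_left₀ hl.1.le hl.2 2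

/-- The function `l² 1_{(0,σ]}(l)`. -/
def sqInd (σ : ℝ) : HalfL2 := (memLp_sq_indicator σ).toLp _

theorem inner_sqInd (σ : ℝ) (hσ : 0 ≤ σ) (q : HalfL2) :
    inner ℂ q (sqInd σ) = ∫ l in (0 : ℝ)..σ, conj (q l) * ((l ^ 2 : ℝ) : ℂ) := by
  rw [intervalIntegral.integral_of_le hσ, ← restrict_volHalf_Ioc, ← integral_indicator measurableSet_Ioc,
    L2.inner_def]
  refine integral_congr_ae ?_
  filter_upwards [(memLp_sq_indicator σ).coeFn_toLp] with l hl
  rw [sqInd, hl, RCLike.inner_apply]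
  by_cases h : l ∈ Ioc 0 σ
  · rw [indicator_of_mem h, indicator_of_mem h, mul_comm]
  · rw [indicator_of_notMem h, indicator_of_notMem h, zero_mul]

theorem inner_ind_right (σ : ℝ) (hσ : 0 ≤ σ) (q : HalfL2) :
    inner ℂ q (ind σ) = ∫ l in (0 : ℝ)..σ, conj (q l) := by
  rw [← inner_conj_symm]
  change conj (prim q σ) = _
  rw [prim_eq_integral q hσ, intervalIntegral.integral_of_le hσ, intervalIntegral.integral_of_le hσ,
    integral_conj]

/-- The derivative of `ρ ↦ sineFun σ ρ`. -/
def sineFunDeriv (σ ρ : ℝ) : ℝ :=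
  √(2 / Real.pi) * ((Real.cos (ρ * σ) * σ * ρ - Real.sin (ρ * σ)) / ρ ^ 2)

theorem hasDerivAt_sineFun (σ : ℝ) {ρ : ℝ} (hρ : 0 < ρ) :
    HasDerivAt (sineFun σ) (sineFunDeriv σ ρ) ρ := by
  have h1 : HasDerivAt (fun ρ : ℝ => Real.sin (ρ * σ)) (Real.cos (ρ * σ) * (1 * σ)) ρ :=
    ((hasDerivAt_id ρ).mul_const σ).sin
  refine ((h1.div (hasDerivAt_id ρ) hρ.ne').const_mul √(2 / Real.pi)).congr_deriv ?_
  simp [sineFunDeriv]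

/-- `sineFun σ ρ` is a multiple of `∫₀^σ cos(lρ) dl`; differentiating in `ρ` produces `-∫₀^σ l
sin(lρ) dl`. Weighting the indicator by `l²` thus amounts to one more derivative of the kernel,
ready for integration by parts. -/
theorem prim_cosT_sqInd {σ ρ : ℝ} (hσ : 0 ≤ σ) (hρ : 0 < ρ) :
    prim (cosT (sqInd σ)) ρ = ((-sineFunDeriv σ ρ : ℝ) : ℂ) := by
  have e : prim (cosT (sqInd σ)) ρ =
      ∫ l in (0 : ℝ)..σ, ((√(2 / Real.pi) * (l * Real.sin (l * ρ)) : ℝ) : ℂ) := by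
    rw [prim_cosT hρ, intervalIntegral.integral_of_le hσ, ← restrict_volHalf_Ioc,
      ← integral_indicator measurableSet_Ioc]
    refine integral_congr_ae ?_
    filter_upwards [(memLp_sq_indicator σ).coeFn_toLp, ae_restrict_mem measurableSet_Ioi] with l hl h0
    rw [sqInd, hl]
    by_cases h : l ∈ Ioc 0 σ
    · have := (mem_Ioi.1 h0).ne'
      rw [indicator_of_mem h, indicator_of_mem h, ← Complex.ofReal_mul, sineFun]
      congr 1
      field_simp
    · rw [indicator_of_notMem h, indicator_of_notMem h, mul_zero]
  rw [e, intervalIntegral.integral_ofReal, intervalIntegral.integral_const_mul]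
  have hd : ∀ l ∈ uIcc 0 σ, HasDerivAt
      (fun l : ℝ => (Real.sin (l * ρ) - l * ρ * Real.cos (l * ρ)) / ρ ^ 2) (l * Real.sin (l * ρ)) l := by
    intro l _
    have h1 : HasDerivAt (fun l : ℝ => l * ρ) (1 * ρ) l := (hasDerivAt_id l).mul_const ρ
    refine ((h1.sin.sub (h1.mul h1.cos)).div_const (ρ ^ 2)).congr_deriv ?_
    field_simp
    ring
  rw [intervalIntegral.integral_eq_sub_of_hasDerivAt hd
    ((Continuous.intervalIntegrable (by fun_prop) _ _))]
  congr 1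
  rw [sineFunDeriv]
  simp only [zero_mul, Real.sin_zero, sub_self, zero_div, sub_zero, mul_comm σ ρ]
  ring

theorem abs_sineFun_le_div (σ : ℝ) {ρ : ℝ} (hρ : 0 < ρ) :
    |sineFun σ ρ| ≤ √(2 / Real.pi) * (1 / ρ) := by
  rw [sineFun, abs_mul, abs_of_nonneg (Real.sqrt_nonneg _), abs_div, abs_of_pos hρ]
  gcongr
  exact Real.abs_sin_le_one _

theorem abs_sineFun_le {σ : ℝ} (hσ : 0 ≤ σ) {ρ : ℝ} (hρ : 0 < ρ) :
    |sineFun σ ρ| ≤ √(2 / Real.pi) * σ := by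
  rw [sineFun, abs_mul, abs_of_nonneg (Real.sqrt_nonneg _), abs_div, abs_of_pos hρ]
  gcongr
  rw [div_le_iff₀ hρ]
  refine Real.abs_sin_le_abs.trans ?_
  rw [abs_of_nonneg (by positivity), mul_comm]

theorem force_sineFun_parts (w : HalfL2) (σ : ℝ) {a b : ℝ} (ha : 0 < a) (hab : a ≤ b) :
    ∫ ρ in a..b, (conj (quintic w ρ) * (sineFun σ ρ : ℂ) +
      conj (force w ρ) * (sineFunDeriv σ ρ : ℂ)) =
    conj (force w b) * (sineFun σ b : ℂ) - conj (force w a) * (sineFun σ a : ℂ) := by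
  have hb : 0 ≤ b := (ha.le.trans hab)
  have hsub : uIcc a b ⊆ uIcc 0 b := by
    rw [uIcc_of_le hab, uIcc_of_le hb]
    exact Icc_subset_Icc_left ha.le
  have hpos : ∀ x ∈ uIcc a b, 0 < x := fun x hx => by
    rw [uIcc_of_le hab] at hx
    exact ha.trans_le hx.1
  have h1 := ac_conj ((force_ac w hb).mono hsub)
  have h2 : AbsolutelyContinuousOnInterval (sineFun σ) a b := by
    refine ContDiffOn.absolutelyContinuousOnInterval ?_
    unfold sineFun
    exact contDiffOn_const.mul (ContDiffOn.div (by fun_prop) (by fun_prop)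
      fun x hx => (hpos x hx).ne')
  refine (ac_integral (h1.fun_smul (ac_ofReal h2)) ?_).2
  filter_upwards [force_ae_hasDerivAt w hb] with x hx hm
  have hF : HasDerivAt (fun ρ => conj (force w ρ)) (conj (quintic w x)) x :=
    Complex.conjCLE.hasFDerivAt.comp_hasDerivAt x (hx (hsub hm))
  exact hF.mul (hasDerivAt_sineFun σ (hpos x hm)).ofReal_comp

/-- Integration by parts of `quintic w = (force w)'` against the kernel. At infinity the force is
bounded and the kernel decays like `1/ρ`; at the origin the force tends to `0` and the kernel is
bounded. -/
theorem inner_quintic_sineKer (w : HalfL2) {σ : ℝ} (hσ : 0 ≤ σ) :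
    inner ℂ (quintic w) (sineKer σ) = inner ℂ (potGrad w) (cosT (sqInd σ)) := by
  have i1 : IntegrableOn (fun ρ => conj (quintic w ρ) * (sineFun σ ρ : ℂ)) (Ioi 0) := by
    refine (L2.integrable_inner (𝕜 := ℂ) (quintic w) (sineKer σ)).congr ?_
    filter_upwards [coeFn_sineKer σ] with l hl
    rw [hl, RCLike.inner_apply, mul_comm]
  have i2 : IntegrableOn (fun ρ => conj (force w ρ) * (sineFunDeriv σ ρ : ℂ)) (Ioi 0) := by
    refine (integrable_force_mul_prim w (cosT (sqInd σ))).neg.congr ?_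
    filter_upwards [ae_restrict_mem measurableSet_Ioi] with ρ hρ
    rw [Pi.neg_apply, prim_cosT_sqInd hσ hρ]
    push_cast
    ring
  have e1 : inner ℂ (quintic w) (sineKer σ) =
      ∫ ρ in Ioi (0 : ℝ), conj (quintic w ρ) * (sineFun σ ρ : ℂ) := by
    rw [L2.inner_def]
    refine integral_congr_ae ?_
    filter_upwards [coeFn_sineKer σ] with l hl
    rw [hl, RCLike.inner_apply, mul_comm]
  have e2 : inner ℂ (potGrad w) (cosT (sqInd σ)) =
      -∫ ρ in Ioi (0 : ℝ), conj (force w ρ) * (sineFunDeriv σ ρ : ℂ) := by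
    rw [inner_potGrad, ← integral_neg]
    refine setIntegral_congr_fun measurableSet_Ioi fun ρ hρ => ?_
    rw [prim_cosT_sqInd hσ hρ]
    push_cast
    ring
  rw [e1, e2, ← add_eq_zero_iff_eq_neg, ← integral_add i1 i2]
  -- The parts formula is used on `[1/(n + 1), n + 1]`, away from the division by zero in the
  -- kernel, and the endpoints are then sent to `0` and infinity.
  have ha : Tendsto (fun n : ℕ => 1 / ((n : ℝ) + 1)) atTop (𝓝 0) :=
    tendsto_one_div_add_atTop_nhds_zero_nat
  have hb : Tendsto (fun n : ℕ => (n : ℝ) + 1) atTop atTop :=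
    tendsto_atTop_add_const_right _ _ tendsto_natCast_atTop_atTop
  have hcov : AECover (volume.restrict (Ioi (0 : ℝ))) atTop
      (fun n : ℕ => Ioc (1 / ((n : ℝ) + 1)) ((n : ℝ) + 1)) :=
    (aecover_Ioi_of_Ioi ha).inter (aecover_Iic hb)
  have hlim := hcov.integral_tendsto_of_countably_generated (i1.add i2)
  refine tendsto_nhds_unique hlim ?_
  have hapos : ∀ n : ℕ, 0 < 1 / ((n : ℝ) + 1) := fun n => by positivity
  have hbpos : ∀ n : ℕ, 0 < (n : ℝ) + 1 := fun n => by positivity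
  have hab : ∀ n : ℕ, 1 / ((n : ℝ) + 1) ≤ (n : ℝ) + 1 := fun n => by
    rw [div_le_iff₀ (hbpos n)]; nlinarith [(Nat.cast_nonneg n : (0 : ℝ) ≤ n)]
  have he : ∀ n : ℕ, ∫ ρ in Ioc (1 / ((n : ℝ) + 1)) ((n : ℝ) + 1),
      ((fun ρ => conj (quintic w ρ) * (sineFun σ ρ : ℂ)) +
        fun ρ => conj (force w ρ) * (sineFunDeriv σ ρ : ℂ)) ρ ∂volHalf =
      conj (force w ((n : ℝ) + 1)) * (sineFun σ ((n : ℝ) + 1) : ℂ) -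
        conj (force w (1 / ((n : ℝ) + 1))) * (sineFun σ (1 / ((n : ℝ) + 1)) : ℂ) := fun n => by
    have hsub : Ioc (1 / ((n : ℝ) + 1)) ((n : ℝ) + 1) ⊆ Ioi 0 := fun x hx => (hapos n).trans hx.1
    rw [← force_sineFun_parts w σ (hapos n) (hab n), intervalIntegral.integral_of_le (hab n),
      Measure.restrict_restrict measurableSet_Ioc,
      inter_eq_left.2 hsub]
    rfl
  simp_rw [he]
  rw [show (0 : ℂ) = 0 - 0 by simp]
  refine Tendsto.sub ?_ ?_
  · refine squeeze_zero_norm (a := fun n : ℕ => ‖w‖ ^ 5 * (√(2 / Real.pi) * (1 / ((n : ℝ) + 1))))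
      (fun n => ?_) (by simpa only [mul_zero] using (ha.const_mul √(2 / Real.pi)).const_mul (‖w‖ ^ 5))
    rw [norm_mul, Complex.norm_conj, Complex.norm_real]
    exact mul_le_mul (norm_force_le w (hbpos n).le) (abs_sineFun_le_div σ (hbpos n))
      (norm_nonneg _) (by positivity)
  · have hs : Tendsto (fun n : ℕ => √(1 / ((n : ℝ) + 1)) * ‖quintic w‖ * (√(2 / Real.pi) * σ))
        atTop (𝓝 0) := by
      have := (ha.sqrt.mul_const ‖quintic w‖).mul_const (√(2 / Real.pi) * σ)
      simpa only [Real.sqrt_zero, zero_mul] using this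
    refine squeeze_zero_norm (fun n => ?_) hs
    rw [norm_mul, Complex.norm_conj, Complex.norm_real, ← prim_quintic w (hapos n).le]
    exact mul_le_mul (norm_prim_le _ _) (abs_sineFun_le hσ (hapos n)) (norm_nonneg _) (by positivity)

/-- On the frequency side the gradient of the potential energy is the nonlinearity divided by the
symbol of the Laplacian. -/
theorem cosT_potGrad_ae (w : HalfL2) :
    ∀ᵐ l ∂volHalf, ((l ^ 2 : ℝ) : ℂ) * cosT (potGrad w) l = cosT (quintic w) l := by
  set q := cosT (potGrad w)
  set n := cosT (quintic w)
  have iq : ∀ R : ℝ, 0 < R → IntervalIntegrable (fun l => conj (q l) * ((l ^ 2 : ℝ) : ℂ)) volume 0 R :=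
    fun R hR => by
      have h := halfL2_intervalIntegrable q le_rfl hR.le
      have hc : IntervalIntegrable (fun l => conj (q l)) volume 0 R := by
        rw [intervalIntegrable_iff] at h ⊢
        exact Complex.conjCLE.toContinuousLinearMap.integrable_comp h
      exact hc.mul_continuousOn (by fun_prop)
  have inn : ∀ R : ℝ, 0 < R → IntervalIntegrable (fun l => conj (n l)) volume 0 R :=
    fun R hR => by
      have h := halfL2_intervalIntegrable n le_rfl hR.le
      rw [intervalIntegrable_iff] at h ⊢
      exact Complex.conjCLE.toContinuousLinearMap.integrable_comp h
  -- Both sides are tested against all indicators of `(0, R]`. They appear conjugated because the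
  -- inner product is conjugate-linear in its first argument.
  have h := ae_eq_zero_of_primitive_eq_zero
    (f := fun l => conj (q l) * ((l ^ 2 : ℝ) : ℂ) - conj (n l))
    (fun R hR => (iq R hR).sub (inn R hR)) (fun R hR => by
      rw [intervalIntegral.integral_sub (iq R hR) (inn R hR), ← inner_sqInd R hR.le,
        ← inner_ind_right R hR.le, inner_cosT_left, inner_cosT_left, cosT_ind hR,
        inner_quintic_sineKer w hR.le, sub_self])
  filter_upwards [h] with l hl
  have := congrArg conj (sub_eq_zero.1 hl)
  rw [map_mul, Complex.conj_conj, Complex.conj_conj, Complex.conj_ofReal] at this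
  rw [mul_comm, this]

end Elliptic

/-! ### Difference quotients of the free flow, tested against the gradient. -/

section DifferenceQuotient

open BoundedContinuousFunction

/-- The difference quotient `(e^{-il²τ} - 1) / (τ l²)`, continuously extended. -/
def phaseQuot (τ : ℝ) : ℝ →ᵇ ℂ :=
  BoundedContinuousFunction.ofNormedAddCommGroup
    (fun l : ℝ => -Complex.I * ∫ s in (0 : ℝ)..1, phase (s * τ) l)
    (continuous_const.mul (intervalIntegral.continuous_parametric_intervalIntegral_of_continuous'
      (by simp only [phase_apply]; fun_prop) 0 1)) 1
    (fun l => by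
      rw [norm_mul, norm_neg, Complex.norm_I, one_mul]
      refine (intervalIntegral.norm_integral_le_of_norm_le_const
        (C := 1) fun s _ => (norm_phase_apply _ _).le).trans ?_
      simp)

theorem norm_phaseQuot_le (τ : ℝ) : ‖phaseQuot τ‖ ≤ 1 :=
  BoundedContinuousFunction.norm_ofNormedAddCommGroup_le _ zero_le_one _

theorem phaseQuot_apply (τ l : ℝ) :
    phaseQuot τ l = -Complex.I * ∫ s in (0 : ℝ)..1, phase (s * τ) l := rfl

theorem mul_phaseQuot (τ l : ℝ) : ((l ^ 2 : ℝ) : ℂ) * (τ * phaseQuot τ l) = phase τ l - 1 := by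
  rw [phaseQuot_apply]
  by_cases h : -Complex.I * (l : ℂ) ^ 2 * (τ : ℂ) = 0
  · rw [phase_apply, h, Complex.exp_zero, sub_self]
    have : (l : ℂ) ^ 2 * (τ : ℂ) = 0 := by simpa using h
    push_cast
    linear_combination (-Complex.I * ∫ s in (0 : ℝ)..1, phase (s * τ) l) * this
  · have e : ∫ s in (0 : ℝ)..1, phase (s * τ) l =
        ∫ s in (0 : ℝ)..1, Complex.exp ((-Complex.I * (l : ℂ) ^ 2 * (τ : ℂ)) * s) := by
      refine intervalIntegral.integral_congr fun s _ => ?_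
      simp only [phase_apply]
      congr 1
      push_cast
      ring
    rw [e, integral_exp_mul_complex h, phase_apply]
    push_cast
    have hl : (l : ℂ) ≠ 0 := fun h0 => h (by rw [h0]; ring)
    have hτ : (τ : ℂ) ≠ 0 := fun h0 => h (by rw [h0]; ring)
    rw [mul_one, mul_zero, Complex.exp_zero]
    field_simp

theorem tendsto_phaseQuot (w : HalfL2) :
    Tendsto (fun τ => mulBCF (phaseQuot τ) w) (𝓝 0) (𝓝 (-Complex.I • w)) := by
  have h : mulBCF ((-Complex.I) • (1 : ℝ →ᵇ ℂ)) w = -Complex.I • w := by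
    rw [map_smul, _root_.smul_apply, mulBCF_one]
  rw [← h]
  refine tendsto_mulBCF (C := 1) (.of_forall norm_phaseQuot_le) (fun l _ => ?_) w
  have hc : Continuous fun τ : ℝ => phaseQuot τ l := by
    simp only [phaseQuot_apply]
    exact continuous_const.mul (intervalIntegral.continuous_parametric_intervalIntegral_of_continuous'
      (by simp only [phase_apply]; fun_prop) 0 1)
  have h0 : phaseQuot 0 l = ((-Complex.I) • (1 : ℝ →ᵇ ℂ)) l := by
    simp [phaseQuot_apply, phase_zero]
  rw [← h0]
  exact hc.tendsto 0

/-- On the frequency side the increment is `l² τ` times a multiplier bounded uniformly in `τ`, and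
the factor `l²` is handed to the gradient, which it turns into the nonlinearity. An explicit factor
`τ` thus appears although `w` need not lie in the domain of the generator. -/
theorem inner_potGrad_prop_sub (v w : HalfL2) (τ : ℝ) :
    inner ℂ (potGrad v) (prop τ w - w) =
      τ * inner ℂ (quintic v) (cosT (mulBCF (phaseQuot τ) (cosT w))) := by
  have e : prop τ w - w = cosT (mulBCF (phase τ) (cosT w) - cosT w) := by
    rw [map_sub, cosT_cosT, prop_apply]
  rw [e, ← inner_cosT_left, ← inner_cosT_left, ← inner_smul_right, L2.inner_def, L2.inner_def]
  refine integral_congr_ae ?_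
  filter_upwards [cosT_potGrad_ae v, Lp.coeFn_sub (mulBCF (phase τ) (cosT w)) (cosT w),
    coeFn_mulBCF (phase τ) (cosT w), coeFn_mulBCF (phaseQuot τ) (cosT w),
    Lp.coeFn_smul (τ : ℂ) (mulBCF (phaseQuot τ) (cosT w))] with l h1 h2 h3 h4 h5
  rw [h2, Pi.sub_apply, h3, h5, Pi.smul_apply, h4, ← h1, RCLike.inner_apply, RCLike.inner_apply,
    map_mul, Complex.conj_ofReal, smul_eq_mul]
  have := mul_phaseQuot τ l
  linear_combination (-(cosT w l) * conj (cosT (potGrad v) l)) * this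

end DifferenceQuotient

/-! ### Conservation of the Hamiltonian. -/

section Conservation

/-- The Hamiltonian in terms of the derivative of the reduced profile. -/
def hamiltonian (w : HalfL2) : ℝ := ‖w‖ ^ 2 / 2 + potential w

/-- Mild solutions of the equation for the derivative of the reduced profile. -/
structure IsMild (I : Set ℝ) (w : ℝ → HalfL2) : Prop where
  cont : ContinuousOn w I
  duhamel : ∀ t₀ ∈ I, ∀ t₁ ∈ I, w t₁ = prop (t₁ - t₀) (w t₀)
    - Complex.I • ∫ t in t₀..t₁, prop (t₁ - t) (quintic (w t))

theorem inner_potGrad_quintic_im (w : HalfL2) : (inner ℂ (potGrad w) (quintic w)).im = 0 := by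
  have h : inner ℂ (potGrad w) (quintic w) = ((∫ ρ in Ioi (0 : ℝ), ‖force w ρ‖ ^ 2 : ℝ) : ℂ) := by
    rw [inner_potGrad, ← integral_complex_ofReal]
    refine setIntegral_congr_fun measurableSet_Ioi fun ρ hρ => ?_
    rw [prim_quintic w (le_of_lt hρ), mul_comm, Complex.mul_conj, Complex.normSq_eq_norm_sq]
  rw [h, Complex.ofReal_im]

/-- Since `prop (t - s) = prop t ∘ prop (-s)`, the Duhamel integral is `prop t` applied to a
primitive of a continuous function; `K t` is `prop t` of its slope. -/
theorem IsMild.exists_increment {a b : ℝ} {w : ℝ → HalfL2} (h : IsMild (Icc a b) w) {t₀ : ℝ}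
    (ht₀ : t₀ ∈ Icc a b) : ∃ K : ℝ → HalfL2,
      Tendsto K (𝓝[≠] t₀) (𝓝 (quintic (w t₀))) ∧
      ∀ t ∈ Icc a b, t ≠ t₀ →
        w t = prop (t - t₀) (w t₀) - ((t - t₀ : ℝ) : ℂ) • (Complex.I • K t) := by
  have hab : a ≤ b := ht₀.1.trans ht₀.2
  -- Projecting time to `[a, b]` makes the integrand continuous on all of `ℝ`, so endpoints need no
  -- separate treatment.
  obtain ⟨N, hN⟩ : ∃ N : ℝ → HalfL2,
    ∀ t, N t = prop (-t) (quintic (w (projIcc a b hab t))) := ⟨_, fun t => rfl⟩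
  have hNc : Continuous N := by
    have h1 : Continuous fun t => w (projIcc a b hab t) :=
      h.cont.comp_continuous (continuous_subtype_val.comp continuous_projIcc) fun t =>
        (projIcc a b hab t).2
    have h2 : Continuous fun t => quintic (w (projIcc a b hab t)) := continuous_quintic.comp h1
    have h3 : Continuous fun t : ℝ => ((-t, quintic (w (projIcc a b hab t))) : ℝ × HalfL2) :=
      continuous_neg.prodMk h2
    exact (continuous_prop.comp h3).congr fun t => (hN t).symm
  set J : ℝ → HalfL2 := fun t => ∫ s in t₀..t, N s with hJ
  have hJd : HasDerivAt J (N t₀) t₀ :=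
    intervalIntegral.integral_hasDerivAt_right (hNc.intervalIntegrable _ _)
      hNc.stronglyMeasurable.stronglyMeasurableAtFilter hNc.continuousAt
  refine ⟨fun t => prop t ((t - t₀)⁻¹ • J t), ?_, fun t ht hne => ?_⟩
  · have hs := hasDerivAt_iff_tendsto_slope.1 hJd
    have hs' : Tendsto (fun t => (t - t₀)⁻¹ • J t) (𝓝[≠] t₀) (𝓝 (N t₀)) := by
      refine hs.congr fun t => ?_
      rw [slope_def_module]
      simp [hJ]
    have hid : Tendsto (fun t : ℝ => t) (𝓝[≠] t₀) (𝓝 t₀) := tendsto_nhdsWithin_of_tendsto_nhds tendsto_id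
    have := (continuous_prop.tendsto (t₀, N t₀)).comp (hid.prodMk_nhds hs')
    have e : prop t₀ (N t₀) = quintic (w t₀) := by
      rw [hN, ← prop_add, add_neg_cancel, prop_zero, projIcc_of_mem hab ht₀]
    rwa [e] at this
  · rw [h.duhamel t₀ ht₀ t ht, smul_comm]
    congr 2
    have hne' : ((t - t₀ : ℝ) : ℂ) ≠ 0 := by exact_mod_cast sub_ne_zero.2 hne
    have e1 : ∫ s in t₀..t, prop (t - s) (quintic (w s)) = ∫ s in t₀..t, prop t (N s) := by
      refine intervalIntegral.integral_congr fun s hs => ?_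
      have hsI : s ∈ Icc a b := uIcc_subset_Icc ht₀ ht hs
      rw [hN, ← prop_add, projIcc_of_mem hab hsI, sub_eq_add_neg]
    rw [e1, ContinuousLinearMap.intervalIntegral_comp_comm _ (hNc.intervalIntegrable _ _)]
    have e2 : (t - t₀)⁻¹ • J t = (((t - t₀ : ℝ) : ℂ)⁻¹) • J t := by
      rw [← Complex.ofReal_inv]; rfl
    change _ = ((t - t₀ : ℝ) : ℂ) • prop t ((t - t₀)⁻¹ • J t)
    rw [e2, map_smul, smul_inv_smul₀ hne']

/-- The increment of `w` is split into its free and Duhamel parts. After division by `t - t₀` every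
contribution has a limit, the free part of the potential through `inner_potGrad_prop_sub`. -/
theorem IsMild.hasDerivWithinAt_hamiltonian {a b : ℝ} {w : ℝ → HalfL2} (h : IsMild (Icc a b) w)
    {t₀ : ℝ} (ht₀ : t₀ ∈ Icc a b) :
    HasDerivWithinAt (fun t => hamiltonian (w t)) 0 (Icc a b) t₀ := by
  obtain ⟨K, hK, hw⟩ := h.exists_increment ht₀
  rw [hasDerivWithinAt_iff_tendsto_slope]
  have hle : 𝓝[Icc a b \ {t₀}] t₀ ≤ 𝓝[≠] t₀ := nhdsWithin_mono _ (fun x hx => hx.2)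
  replace hK := hK.mono_left hle
  set l := 𝓝[Icc a b \ {t₀}] t₀ with hl
  choose s hs hP using fun t => exists_potential_sub (w t₀) (w t - w t₀)
  have hwt : Tendsto w l (𝓝 (w t₀)) := (h.cont t₀ ht₀).mono_left (nhdsWithin_mono _ sdiff_subset)
  have hτ : Tendsto (fun t => t - t₀) l (𝓝 0) := by
    have : Tendsto (fun t => t - t₀) (𝓝 t₀) (𝓝 (t₀ - t₀)) := tendsto_id.sub_const t₀
    rw [sub_self] at this
    exact this.mono_left nhdsWithin_le_nhds
  have hmid : Tendsto (fun t => w t₀ + (s t : ℂ) • (w t - w t₀)) l (𝓝 (w t₀)) := by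
    have hz : Tendsto (fun t => (s t : ℂ) • (w t - w t₀)) l (𝓝 0) := by
      have h0 : Tendsto (fun t => ‖w t - w t₀‖) l (𝓝 0) := tendsto_iff_norm_sub_tendsto_zero.1 hwt
      refine squeeze_zero_norm (fun t => ?_) h0
      rw [norm_smul, Complex.norm_real, Real.norm_of_nonneg (hs t).1.le]
      exact mul_le_of_le_one_left (norm_nonneg _) (hs t).2.le
    simpa using hz.const_add (w t₀)
  have hprop : Tendsto (fun t => prop (t - t₀) (w t₀)) l (𝓝 (w t₀)) := by
    have := ((continuous_prop_apply (w t₀)).tendsto 0).comp hτ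
    rwa [prop_zero] at this
  have hIK := hK.const_smul Complex.I
  -- the four contributions to the difference quotient
  have hlim : Tendsto (fun t =>
      -(inner ℂ (prop (t - t₀) (w t₀)) (Complex.I • K t)).re + (t - t₀) * ‖K t‖ ^ 2 / 2 +
      ((inner ℂ (quintic (w t₀ + (s t : ℂ) • (w t - w t₀)))
        (cosT (mulBCF (phaseQuot (t - t₀)) (cosT (w t₀))))).re -
      (inner ℂ (potGrad (w t₀ + (s t : ℂ) • (w t - w t₀))) (Complex.I • K t)).re)) l
      (𝓝 (-(inner ℂ (w t₀) (Complex.I • quintic (w t₀))).re + 0 * ‖quintic (w t₀)‖ ^ 2 / 2 +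
      ((inner ℂ (quintic (w t₀)) (cosT (-Complex.I • cosT (w t₀)))).re -
      (inner ℂ (potGrad (w t₀)) (Complex.I • quintic (w t₀))).re))) := by
    have hD := (cosT.continuous.tendsto _).comp ((tendsto_phaseQuot (cosT (w t₀))).comp hτ)
    have hre := Complex.continuous_re.tendsto
    refine Tendsto.add (Tendsto.add ?_ ?_) (Tendsto.sub ?_ ?_)
    · exact ((hre _).comp (hprop.inner hIK)).neg
    · exact (hτ.mul (hK.norm.pow 2)).div_const 2
    · exact (hre _).comp (((continuous_quintic.tendsto _).comp hmid).inner hD)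
    · exact (hre _).comp (((continuous_potGrad.tendsto _).comp hmid).inner hIK)
  -- The kinetic term cancels the free part of the potential, by conjugate symmetry of the inner
  -- product. The last term vanishes because the gradient pairs with the nonlinearity to the real
  -- number `∫ |force|²`.
  have hzero : -(inner ℂ (w t₀) (Complex.I • quintic (w t₀))).re + 0 * ‖quintic (w t₀)‖ ^ 2 / 2 +
      ((inner ℂ (quintic (w t₀)) (cosT (-Complex.I • cosT (w t₀)))).re -
      (inner ℂ (potGrad (w t₀)) (Complex.I • quintic (w t₀))).re) = 0 := by
    rw [map_smul, cosT_cosT, inner_smul_right, inner_smul_right, inner_smul_right,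
      ← inner_conj_symm (w t₀) (quintic (w t₀))]
    simp only [Complex.mul_re, Complex.neg_re, Complex.neg_im, Complex.I_re, Complex.I_im,
      Complex.conj_im, inner_potGrad_quintic_im]
    ring
  rw [hzero] at hlim
  refine hlim.congr' ?_
  filter_upwards [self_mem_nhdsWithin] with t ht
  have hne : t ≠ t₀ := ht.2
  have hne' : t - t₀ ≠ 0 := sub_ne_zero.2 hne
  have hwt' := hw t ht.1 hne
  have hkin : ‖w t‖ ^ 2 = ‖w t₀‖ ^ 2 -
      2 * ((t - t₀) * (inner ℂ (prop (t - t₀) (w t₀)) (Complex.I • K t)).re) +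
      (t - t₀) ^ 2 * ‖K t‖ ^ 2 := by
    rw [hwt', @norm_sub_sq ℂ, norm_prop, inner_smul_right, norm_smul, norm_smul, Complex.norm_I,
      Complex.norm_real, RCLike.re_eq_complex_re, Complex.re_ofReal_mul, one_mul, mul_pow,
      Real.norm_eq_abs, sq_abs]
  have hpot : potential (w t) - potential (w t₀) = (t - t₀) *
      ((inner ℂ (quintic (w t₀ + (s t : ℂ) • (w t - w t₀)))
        (cosT (mulBCF (phaseQuot (t - t₀)) (cosT (w t₀))))).re -
      (inner ℂ (potGrad (w t₀ + (s t : ℂ) • (w t - w t₀))) (Complex.I • K t)).re) := by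
    have h1 := hP t
    rw [add_sub_cancel] at h1
    rw [h1]
    set v := w t₀ + (s t : ℂ) • (w t - w t₀)
    have e : w t - w t₀ = (prop (t - t₀) (w t₀) - w t₀) -
        ((t - t₀ : ℝ) : ℂ) • (Complex.I • K t) := by
      rw [hwt']; abel
    rw [e, inner_sub_right, inner_potGrad_prop_sub, inner_smul_right, Complex.sub_re,
      Complex.re_ofReal_mul, Complex.re_ofReal_mul, mul_sub]
  rw [slope_def_field, hamiltonian, hamiltonian, eq_div_iff hne']
  have e : ‖w t‖ ^ 2 / 2 + potential (w t) - (‖w t₀‖ ^ 2 / 2 + potential (w t₀)) =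
      (‖w t‖ ^ 2 - ‖w t₀‖ ^ 2) / 2 + (potential (w t) - potential (w t₀)) := by ring
  rw [e, hpot, hkin]
  ring

theorem IsMild.hamiltonian_eq {a b : ℝ} {w : ℝ → HalfL2} (h : IsMild (Icc a b) w) {s t : ℝ}
    (hs : s ∈ Icc a b) (ht : t ∈ Icc a b) : hamiltonian (w s) = hamiltonian (w t) := by
  have hab : a ≤ b := hs.1.trans hs.2
  have hc := constant_of_derivWithin_zero (f := fun t => hamiltonian (w t)) (a := a) (b := b)
    (fun x hx => (h.hasDerivWithinAt_hamiltonian hx).differentiableWithinAt) (fun x hx =>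
      (h.hasDerivWithinAt_hamiltonian (Ico_subset_Icc_self hx)).derivWithin
        (uniqueDiffOn_Icc (hx.1.trans_lt hx.2) x (Ico_subset_Icc_self hx)))
  rw [hc s hs, hc t ht]

/-- The potential is nonnegative at the later point of comparison and at most `‖w‖⁶` at the
reference point. -/
theorem IsMild.norm_sq_le {a b : ℝ} {w : ℝ → HalfL2} (h : IsMild (Icc a b) w) {s t : ℝ}
    (hs : s ∈ Icc a b) (ht : t ∈ Icc a b) : ‖w t‖ ^ 2 ≤ ‖w s‖ ^ 2 + 2 * ‖w s‖ ^ 6 := by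
  have h1 := h.hamiltonian_eq hs ht
  have h2 := potential_nonneg (w t)
  have h3 := potential_le (w s)
  rw [hamiltonian, hamiltonian] at h1
  linarith

end Conservation

/-! ### Gradients and integrals of radial functions in polar coordinates. -/

section Radial

theorem isOpen_Omega : IsOpen Omega := isOpen_lt continuous_const continuous_norm

theorem measurableSet_Omega : MeasurableSet Omega := isOpen_Omega.measurableSet

theorem norm_grad_of_radial {f : E3 → ℂ} {g : ℝ → ℂ} (hf : ∀ x ∈ Omega, f x = g ‖x‖) {x : E3}
    (hx : x ∈ Omega) (hg : DifferentiableAt ℝ g ‖x‖) : ‖grad f x‖ = ‖deriv g ‖x‖‖ := by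
  have hx1 : 1 < ‖x‖ := hx
  have hx0 : 0 < ‖x‖ := by linarith
  have hn : HasFDerivAt (fun y : E3 => ‖y‖) ((1 / (2 * √(‖x‖ ^ 2))) • (2 • innerSL ℝ x)) x := by
    have := (hasStrictFDerivAt_norm_sq x).hasFDerivAt.sqrt (by positivity)
    simpa only [Real.sqrt_sq (norm_nonneg _)] using this
  have hd := (hg.hasDerivAt.hasFDerivAt.comp x hn).congr_of_eventuallyEq
    (f₁ := f) (by filter_upwards [isOpen_Omega.mem_nhds hx] with y hy using hf y hy)
  have hc : ∀ i, grad f x i = ((x i / ‖x‖ : ℝ) : ℂ) * deriv g ‖x‖ := by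
    intro i
    change fderiv ℝ f x (EuclideanSpace.single i (1 : ℝ)) = _
    rw [hd.fderiv, Real.sqrt_sq (norm_nonneg _)]
    simp [EuclideanSpace.inner_single_right]
    ring
  have hs : ‖grad f x‖ ^ 2 = ‖deriv g ‖x‖‖ ^ 2 := by
    rw [EuclideanSpace.norm_sq_eq]
    simp_rw [hc, norm_mul, mul_pow, Complex.norm_real]
    rw [← Finset.sum_mul]
    have : ∑ i, ‖x i / ‖x‖‖ ^ 2 = 1 := by
      simp_rw [norm_div, div_pow, norm_norm]
      rw [← Finset.sum_div, ← EuclideanSpace.norm_sq_eq, div_self (by positivity)]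
    rw [this, one_mul]
  exact (pow_left_inj₀ (norm_nonneg _) (norm_nonneg _) two_ne_zero).1 hs

/-- Polar integration of the indicator of a measurable null set containing the exceptional radii. -/
theorem ae_norm_of_ae {p : ℝ → Prop} (h : ∀ᵐ r : ℝ, p r) : ∀ᵐ x : E3, p ‖x‖ := by
  set S := toMeasurable volume {r | ¬ p r} with hS
  have hS0 : volume S = 0 := by rw [hS, measure_toMeasurable]; exact h
  have hz : (fun y : ℝ => y ^ (Module.finrank ℝ E3 - 1) • S.indicator (1 : ℝ → ℝ) y)
      =ᵐ[volume.restrict (Ioi 0)] 0 := by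
    refine ae_restrict_of_ae ?_
    filter_upwards [compl_mem_ae_iff.2 hS0] with y hy
    simp [indicator_of_notMem hy]
  have hi : Integrable (fun x : E3 => S.indicator (1 : ℝ → ℝ) ‖x‖) :=
    (integrable_fun_norm_addHaar volume).2 ((integrable_zero _ _ _).congr hz.symm)
  have h0 : ∫ x : E3, S.indicator (1 : ℝ → ℝ) ‖x‖ = 0 := by
    rw [integral_fun_norm_addHaar, integral_congr_ae hz]
    simp
  have hnn : 0 ≤ fun x : E3 => S.indicator (1 : ℝ → ℝ) ‖x‖ := fun x =>
    indicator_nonneg (fun _ _ => zero_le_one) _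
  filter_upwards [(integral_eq_zero_iff_of_nonneg hnn hi).1 h0] with x hx
  by_contra hp
  have : ‖x‖ ∈ S := subset_toMeasurable _ _ hp
  simp [indicator_of_mem this] at hx

/-- The area of the unit sphere. -/
def sphereArea : ℝ := 3 * (volume : Measure E3).real (Metric.ball 0 1)

theorem sphereArea_pos : 0 < sphereArea :=
  mul_pos three_pos (ENNReal.toReal_pos (Metric.measure_ball_pos _ _ one_pos).ne'
    measure_ball_lt_top.ne)

theorem radial_indicator (φ : ℝ → ℝ) : Omega.indicator (fun x => φ ‖x‖) =
    fun x => (Ioi (1 : ℝ)).indicator φ ‖x‖ := by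
  ext x
  by_cases h : 1 < ‖x‖
  · rw [indicator_of_mem (show x ∈ Omega from h), indicator_of_mem (show ‖x‖ ∈ Ioi 1 from h)]
  · rw [indicator_of_notMem (show x ∉ Omega from h), indicator_of_notMem (show ‖x‖ ∉ Ioi 1 from h)]

theorem smul_indicator_Ioi (φ : ℝ → ℝ) :
    (fun y : ℝ => y ^ (Module.finrank ℝ E3 - 1) • (Ioi (1 : ℝ)).indicator φ y) =
      (Ioi (1 : ℝ)).indicator fun y => y ^ 2 * φ y := by
  ext y
  by_cases h : y ∈ Ioi (1 : ℝ)
  · simp [indicator_of_mem h]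
  · simp [indicator_of_notMem h]

theorem integrable_radial_iff (φ : ℝ → ℝ) : Integrable (fun x => φ ‖x‖) volOmega ↔
    IntegrableOn (fun r => r ^ 2 * φ r) (Ioi 1) := by
  rw [volOmega, ← IntegrableOn, ← integrable_indicator_iff measurableSet_Omega, radial_indicator,
    integrable_fun_norm_addHaar, smul_indicator_Ioi, IntegrableOn,
    integrable_indicator_iff measurableSet_Ioi, IntegrableOn,
    Measure.restrict_restrict measurableSet_Ioi,
    inter_eq_left.2 (Ioi_subset_Ioi zero_le_one), IntegrableOn]

theorem integral_radial (φ : ℝ → ℝ) : ∫ x in Omega, φ ‖x‖ =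
    sphereArea * ∫ r in Ioi (1 : ℝ), r ^ 2 * φ r := by
  rw [← integral_indicator measurableSet_Omega, radial_indicator, integral_fun_norm_addHaar,
    smul_indicator_Ioi, integral_indicator measurableSet_Ioi,
    Measure.restrict_restrict measurableSet_Ioi, inter_eq_left.2 (Ioi_subset_Ioi zero_le_one),
    sphereArea]
  simp [mul_assoc]

end Radial

/-! ### Square-integrability of the derivative of `r g(r)`. -/

section ReducedProfile

variable {g : ℝ → ℂ}

/-- Expanding the square gives `|(rg)'|² = r²|g'|² + (r|g|²)'`. -/
theorem integral_norm_sq_reduced (hac : ∀ R : ℝ, 1 < R → AbsolutelyContinuousOnInterval g 1 R)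
    (hg1 : g 1 = 0) (hD : IntegrableOn (fun r => r ^ 2 * ‖deriv g r‖ ^ 2) (Ioi 1)) {R : ℝ}
    (hR : 1 < R) :
    IntervalIntegrable (fun r => ‖g r + r * deriv g r‖ ^ 2) volume 1 R ∧
      ∫ r in (1 : ℝ)..R, ‖g r + r * deriv g r‖ ^ 2 =
        (∫ r in (1 : ℝ)..R, r ^ 2 * ‖deriv g r‖ ^ 2) + R * ‖g R‖ ^ 2 := by
  have hid : AbsolutelyContinuousOnInterval (fun r : ℝ => r) 1 R :=
    ContDiffOn.absolutelyContinuousOnInterval (by fun_prop)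
  have h1 := hid.fun_mul (ac_normSq (hac R hR))
  have hder : ∀ᵐ r : ℝ, r ∈ uIcc 1 R → HasDerivAt (fun r => r * ‖g r‖ ^ 2)
      (1 * ‖g r‖ ^ 2 + r * (2 * inner ℝ (g r) (deriv g r))) r := by
    filter_upwards [ac_ae_differentiableAt (hac R hR)] with r hr hm
    exact (hasDerivAt_id r).mul (hr hm).hasDerivAt.norm_sq
  obtain ⟨hi, he⟩ := ac_integral_real h1 hder
  have hDi : IntervalIntegrable (fun r => r ^ 2 * ‖deriv g r‖ ^ 2) volume 1 R := by
    rw [intervalIntegrable_iff, uIoc_of_le hR.le]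
    exact hD.mono_set Ioc_subset_Ioi_self
  have e : (fun r : ℝ => ‖g r + r * deriv g r‖ ^ 2) = fun r =>
      r ^ 2 * ‖deriv g r‖ ^ 2 + (1 * ‖g r‖ ^ 2 + r * (2 * inner ℝ (g r) (deriv g r))) := by
    ext r
    have : (r : ℂ) * deriv g r = r • deriv g r := rfl
    rw [this, norm_add_sq_real, inner_smul_right, norm_smul, mul_pow, Real.norm_eq_abs, sq_abs]
    ring
  rw [e]
  refine ⟨hDi.add hi, ?_⟩
  rw [intervalIntegral.integral_add hDi hi, he]
  simp [hg1]

/-- Otherwise `r²|g|⁶ ≥ ε³/r` near infinity. The `L⁶` hypothesis thus removes the boundary term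
along a sequence of radii. -/
theorem exists_small_of_integrable (hL : IntegrableOn (fun r => r ^ 2 * ‖g r‖ ^ 6) (Ioi 1)) {ε : ℝ}
    (hε : 0 < ε) {R : ℝ} (hR : 1 < R) : ∃ r, R ≤ r ∧ r * ‖g r‖ ^ 2 < ε := by
  by_contra! hcon
  refine not_integrableOn_Ioi_inv (a := R) ?_
  have hi : IntegrableOn (fun r => (ε ^ 3)⁻¹ * (r ^ 2 * ‖g r‖ ^ 6)) (Ioi R) :=
    (hL.mono_set (Ioi_subset_Ioi hR.le)).const_mul _
  refine Integrable.mono' hi (by fun_prop) ?_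
  filter_upwards [ae_restrict_mem measurableSet_Ioi] with r hr
  have hr0 : 0 < r := by linarith [mem_Ioi.1 hr]
  rw [Real.norm_of_nonneg (by positivity)]
  have h := pow_le_pow_left₀ hε.le (hcon r (le_of_lt hr)) 3
  rw [inv_mul_eq_div, le_div_iff₀ (by positivity), inv_mul_le_iff₀ hr0]
  calc ε ^ 3 ≤ _ := h
    _ = _ := by ring

theorem integral_norm_sq_reduced_le
    (hac : ∀ R : ℝ, 1 < R → AbsolutelyContinuousOnInterval g 1 R)
    (hg1 : g 1 = 0) (hD : IntegrableOn (fun r => r ^ 2 * ‖deriv g r‖ ^ 2) (Ioi 1))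
    (hL : IntegrableOn (fun r => r ^ 2 * ‖g r‖ ^ 6) (Ioi 1)) {R : ℝ} (hR : 1 < R) :
    ∫ r in (1 : ℝ)..R, ‖g r + r * deriv g r‖ ^ 2 ≤
      ∫ r in Ioi (1 : ℝ), r ^ 2 * ‖deriv g r‖ ^ 2 := by
  refine le_of_forall_pos_le_add fun ε hε => ?_
  obtain ⟨R', hRR', hsm⟩ := exists_small_of_integrable hL hε hR
  have hR' : 1 < R' := hR.trans_le hRR'
  obtain ⟨hi, he⟩ := integral_norm_sq_reduced hac hg1 hD hR'
  calc ∫ r in (1 : ℝ)..R, ‖g r + r * deriv g r‖ ^ 2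
      ≤ ∫ r in (1 : ℝ)..R', ‖g r + r * deriv g r‖ ^ 2 :=
        intervalIntegral.integral_mono_interval le_rfl hR.le hRR'
          (.of_forall fun r => by positivity) hi
    _ = (∫ r in (1 : ℝ)..R', r ^ 2 * ‖deriv g r‖ ^ 2) + R' * ‖g R'‖ ^ 2 := he
    _ ≤ (∫ r in Ioi (1 : ℝ), r ^ 2 * ‖deriv g r‖ ^ 2) + ε := by
        refine add_le_add ?_ hsm.le
        rw [intervalIntegral.integral_of_le hR'.le]
        exact setIntegral_mono_set hD (.of_forall fun r => by positivity)
          Ioc_subset_Ioi_self.eventuallyLE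

theorem exists_prim_eq (hac : ∀ R : ℝ, 1 < R → AbsolutelyContinuousOnInterval g 1 R)
    (hg1 : g 1 = 0) (hD : IntegrableOn (fun r => r ^ 2 * ‖deriv g r‖ ^ 2) (Ioi 1))
    (hL : IntegrableOn (fun r => r ^ 2 * ‖g r‖ ^ 6) (Ioi 1)) :
    ∃ w : HalfL2, (∀ ρ, 0 < ρ → prim w ρ = (1 + ρ : ℝ) * g (1 + ρ)) ∧
      ‖w‖ ^ 2 ≤ ∫ r in Ioi (1 : ℝ), r ^ 2 * ‖deriv g r‖ ^ 2 := by
  set W : ℝ → ℂ := fun r => g r + r * deriv g r with hW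
  have hb : Tendsto (fun n : ℕ => (n : ℝ) + 2) atTop atTop :=
    tendsto_atTop_add_const_right _ _ tendsto_natCast_atTop_atTop
  have hb1 : ∀ n : ℕ, (1 : ℝ) < (n : ℝ) + 2 := fun n => by
    linarith [(Nat.cast_nonneg n : (0 : ℝ) ≤ n)]
  have hint : IntegrableOn (fun r => ‖W r‖ ^ 2) (Ioi 1) := by
    refine integrableOn_Ioi_of_intervalIntegral_norm_bounded
      (∫ r in Ioi (1 : ℝ), r ^ 2 * ‖deriv g r‖ ^ 2) 1 (l := atTop) (fun n => ?_) hb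
      (.of_forall fun n => ?_)
    · have := (integral_norm_sq_reduced hac hg1 hD (hb1 n)).1
      rwa [intervalIntegrable_iff_integrableOn_Ioc_of_le (hb1 n).le] at this
    · simpa using integral_norm_sq_reduced_le hac hg1 hD hL (hb1 n)
  have hle : ∫ r in Ioi (1 : ℝ), ‖W r‖ ^ 2 ≤ ∫ r in Ioi (1 : ℝ), r ^ 2 * ‖deriv g r‖ ^ 2 :=
    le_of_tendsto (intervalIntegral_tendsto_integral_Ioi 1 hint hb)
      (.of_forall fun n => integral_norm_sq_reduced_le hac hg1 hD hL (hb1 n))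
  have hgc : ContinuousOn g (Ioi 1) := fun r hr => by
    have hr1 : (1 : ℝ) < r := hr
    have h := (hac (r + 1) (by linarith)).continuousOn
    rw [uIcc_of_le (by linarith)] at h
    exact ((h r ⟨hr1.le, by linarith⟩).continuousAt
      (Icc_mem_nhds hr1 (by linarith))).continuousWithinAt
  have hWm : AEStronglyMeasurable W (volume.restrict (Ioi 1)) :=
    (hgc.aestronglyMeasurable measurableSet_Ioi).add
      ((by fun_prop : Measurable fun r : ℝ => (r : ℂ)).aestronglyMeasurable.mul
        (measurable_deriv g).aestronglyMeasurable)
  have hmp : MeasurePreserving (fun ρ : ℝ => 1 + ρ) volHalf (volume.restrict (Ioi 1)) := by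
    have := (measurePreserving_add_left (volume : Measure ℝ) 1).restrict_preimage
      (measurableSet_Ioi : MeasurableSet (Ioi (1 : ℝ)))
    simpa using this
  have hWp : MemLp W 2 (volume.restrict (Ioi 1)) := (memLp_two_iff_integrable_sq_norm hWm).2 hint
  have hwp : MemLp (fun ρ => W (1 + ρ)) 2 volHalf := hWp.comp_measurePreserving hmp
  refine ⟨hwp.toLp _, fun ρ hρ => ?_, ?_⟩
  · have hR : 1 < 1 + ρ := by linarith
    have hid : AbsolutelyContinuousOnInterval (fun r : ℝ => r) 1 (1 + ρ) :=
      ContDiffOn.absolutelyContinuousOnInterval (by fun_prop)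
    have hftc := (ac_integral ((ac_ofReal hid).fun_smul (hac _ hR)) (f' := W) (by
      filter_upwards [ac_ae_differentiableAt (hac _ hR)] with r hr hm
      refine ((hasDerivAt_id r).ofReal_comp.mul (hr hm).hasDerivAt).congr_deriv ?_
      simp [hW])).2
    rw [prim_eq_integral _ hρ.le]
    have e : ∫ s in (0 : ℝ)..ρ, (hwp.toLp _) s = ∫ s in (0 : ℝ)..ρ, W (1 + s) := by
      refine intervalIntegral.integral_congr_ae ?_
      have := hwp.coeFn_toLp
      rw [EventuallyEq, ae_restrict_iff' measurableSet_Ioi] at this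
      filter_upwards [this] with s hs hm
      rw [uIoc_of_le hρ.le] at hm
      exact hs hm.1
    rw [e, intervalIntegral.integral_comp_add_left (fun r => W r), add_zero, hftc]
    simp [hg1]
  · rw [norm_sq_eq_integral]
    have e : ∫ x in Ioi (0 : ℝ), ‖hwp.toLp _ x‖ ^ 2 = ∫ x in Ioi (0 : ℝ), ‖W (1 + x)‖ ^ 2 := by
      refine integral_congr_ae ?_
      filter_upwards [hwp.coeFn_toLp] with x hx
      rw [hx]
    rw [e]
    refine le_trans (le_of_eq ?_) hle
    exact hmp.integral_comp (measurableEmbedding_addLeft 1) (fun r => ‖W r‖ ^ 2)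

end ReducedProfile

/-! ### Representation of radial `Ḣ¹₀(Ω)` functions by elements of `L²(0,∞)`. -/

section Sobolev

/-- Radial functions vanishing on the unit sphere with locally absolutely continuous profile. -/
def HasProfile (f : E3 → ℂ) : Prop := ∃ g : ℝ → ℂ, (∀ x ∈ Omega, f x = g ‖x‖) ∧
  (∀ R : ℝ, 1 < R → AbsolutelyContinuousOnInterval g 1 R) ∧ g 1 = 0

theorem HasProfile.sub {f₁ f₂ : E3 → ℂ} (h₁ : HasProfile f₁) (h₂ : HasProfile f₂) :
    HasProfile (fun x => f₁ x - f₂ x) := by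
  obtain ⟨g₁, a₁, b₁, c₁⟩ := h₁
  obtain ⟨g₂, a₂, b₂, c₂⟩ := h₂
  exact ⟨g₁ - g₂, fun x hx => congrArg₂ (· - ·) (a₁ x hx) (a₂ x hx), fun R hR => (b₁ R hR).sub (b₂ R hR),
    by simp [c₁, c₂]⟩

/-- Only finiteness of `normH10 f` is assumed of the gradient, so that the result applies to `u t -
u t₀`; the profile supplies a measurable replacement for `|∇f|`. -/
theorem HasProfile.exists_radial {f : E3 → ℂ} (hf : HasProfile f) (h6 : MemLp f 6 volOmega)
    (hfin : normH10 f < ⊤) : ∃ w : HalfL2, (∀ x ∈ Omega, f x = radial w x) ∧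
      sphereArea * ‖w‖ ^ 2 ≤ ∫ x in Omega, ‖grad f x‖ ^ 2 ∧
      ∫ x in Omega, ‖grad f x‖ ^ 2 = (normH10 f).toReal ^ 2 := by
  obtain ⟨g, hfg, hac, hg1⟩ := hf
  have hdiff : ∀ᵐ x ∂volOmega, DifferentiableAt ℝ g ‖x‖ := by
    have h : ∀ᵐ r : ℝ, ∀ n : ℕ, r ∈ uIcc 1 ((n : ℝ) + 2) → DifferentiableAt ℝ g r :=
      ae_all_iff.2 fun n => ac_ae_differentiableAt
        (hac _ (by linarith [(Nat.cast_nonneg n : (0 : ℝ) ≤ n)]))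
    rw [volOmega, ae_restrict_iff' measurableSet_Omega]
    filter_upwards [ae_norm_of_ae h] with x hx hxm
    obtain ⟨n, hn⟩ := exists_nat_ge ‖x‖
    refine hx n ?_
    have h1 : 1 < ‖x‖ := hxm
    rw [uIcc_of_le (by linarith)]
    exact ⟨h1.le, by linarith⟩
  have hnorm : ∀ᵐ x ∂volOmega, ‖grad f x‖ = ‖deriv g ‖x‖‖ := by
    filter_upwards [hdiff, ae_restrict_mem measurableSet_Omega] with x h1 h2
    exact norm_grad_of_radial hfg h2 h1
  have heL : normH10 f = eLpNorm (fun x : E3 => deriv g ‖x‖) 2 volOmega :=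
    eLpNorm_congr_norm_ae hnorm
  have hm : MemLp (fun x : E3 => deriv g ‖x‖) 2 volOmega :=
    ⟨((measurable_deriv g).comp measurable_norm).aestronglyMeasurable, by rw [← heL]; exact hfin⟩
  have hD : IntegrableOn (fun r => r ^ 2 * ‖deriv g r‖ ^ 2) (Ioi 1) :=
    (integrable_radial_iff fun r => ‖deriv g r‖ ^ 2).1 (hm.integrable_norm_pow (by norm_num))
  have hL : IntegrableOn (fun r => r ^ 2 * ‖g r‖ ^ 6) (Ioi 1) := by
    refine (integrable_radial_iff fun r => ‖g r‖ ^ 6).1 ?_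
    refine (h6.integrable_norm_pow (by norm_num)).congr ?_
    filter_upwards [ae_restrict_mem measurableSet_Omega] with x hx
    rw [hfg x hx]
  obtain ⟨w, hw, hwn⟩ := exists_prim_eq hac hg1 hD hL
  have hgi : ∫ x in Omega, ‖grad f x‖ ^ 2 = ∫ x in Omega, ‖deriv g ‖x‖‖ ^ 2 := by
    refine integral_congr_ae ?_
    filter_upwards [hnorm] with x hx
    rw [hx]
  refine ⟨w, fun x hx => ?_, ?_, ?_⟩
  · have hx1 : 1 < ‖x‖ := hx
    have h0 : (‖x‖ : ℂ) ≠ 0 := by exact_mod_cast (by linarith : ‖x‖ ≠ 0)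
    rw [radial, hw _ (by linarith), hfg x hx, add_sub_cancel, mul_div_cancel_left₀ _ h0]
  · rw [hgi, integral_radial fun r => ‖deriv g r‖ ^ 2]
    exact mul_le_mul_of_nonneg_left hwn sphereArea_pos.le
  · rw [hgi, heL, hm.eLpNorm_eq_integral_rpow_norm (by norm_num) (by norm_num),
      ENNReal.toReal_ofReal (by positivity)]
    simp only [ENNReal.toReal_ofNat, Real.rpow_two]
    rw [← one_div, ← Real.sqrt_eq_rpow, Real.sq_sqrt (integral_nonneg fun x => by positivity)]
    rfl

end Sobolev

/-! ### From strong solutions to mild solutions, and the `L¹⁰` estimate. -/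

section Solutions

theorem radial_sub (v w : HalfL2) (x : E3) : radial (v - w) x = radial v x - radial w x := by
  rw [radial, radial, radial, prim_sub, sub_div]

theorem MemH10.exists_radial {f : E3 → ℂ} (hf : MemH10 f) : ∃ w : HalfL2,
    (∀ x ∈ Omega, f x = radial w x) ∧ sphereArea * ‖w‖ ^ 2 ≤ ∫ x in Omega, ‖grad f x‖ ^ 2 := by
  obtain ⟨w, h1, h2, -⟩ := HasProfile.exists_radial hf.1 hf.2.2 hf.2.1.2
  exact ⟨w, h1, h2⟩

theorem IsStrongSolution.continuousOn {I : Set ℝ} {u : ℝ → E3 → ℂ} (hu : IsStrongSolution I u)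
    {w : ℝ → HalfL2} (hw : ∀ t ∈ I, ∀ x ∈ Omega, u t x = radial (w t) x) : ContinuousOn w I := by
  intro t₀ ht₀
  have hlim := hu.cont t₀ ht₀
  -- Convergence to `0` in `ENNReal` makes the norms finite near `t₀`, which allows passage to real
  -- numbers.
  have hfin : ∀ᶠ t in 𝓝[I] t₀, normH10 (fun x => u t x - u t₀ x) < ⊤ :=
    hlim.eventually (gt_mem_nhds ENNReal.zero_lt_top)
  have hreal : Tendsto (fun t => ((normH10 (fun x => u t x - u t₀ x)).toReal ^ 2) / sphereArea)
      (𝓝[I] t₀) (𝓝 0) := by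
    have := (((ENNReal.tendsto_toReal ENNReal.zero_ne_top).comp hlim).pow 2).div_const sphereArea
    simpa using this
  have hsq : Tendsto (fun t => ‖w t - w t₀‖ ^ 2) (𝓝[I] t₀) (𝓝 0) := by
    refine tendsto_of_tendsto_of_tendsto_of_le_of_le' tendsto_const_nhds hreal
      (.of_forall fun t => by positivity) ?_
    filter_upwards [hfin, self_mem_nhdsWithin] with t h1 h2
    obtain ⟨v, hv, hn, he⟩ := HasProfile.exists_radial
      (f := fun x => u t x - u t₀ x) (HasProfile.sub (hu.mem t h2).1 (hu.mem t₀ ht₀).1)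
      ((hu.mem t h2).2.2.sub (hu.mem t₀ ht₀).2.2) h1
    have e : v = w t - w t₀ := eq_of_radial_eq fun x hx => by
      rw [radial_sub, ← hv x hx, hw t h2 x hx, hw t₀ ht₀ x hx]
    rw [← e, le_div_iff₀ sphereArea_pos, mul_comm, ← he]
    exact hn
  have h0 := hsq.sqrt
  simp only [Real.sqrt_sq (norm_nonneg _), Real.sqrt_zero] at h0
  exact tendsto_iff_norm_sub_tendsto_zero.2 h0

theorem radial_smul (c : ℂ) (w : HalfL2) (x : E3) : radial (c • w) x = c * radial w x := by
  rw [radial, radial, prim_smul, mul_div_assoc]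

theorem radial_intervalIntegral {F : ℝ → HalfL2} {a b : ℝ} (hF : IntervalIntegrable F volume a b)
    (x : E3) : radial (∫ t in a..b, F t) x = ∫ t in a..b, radial (F t) x := by
  have h := ContinuousLinearMap.intervalIntegral_comp_comm
    (innerSL ℂ (ind (‖x‖ - 1))) hF
  simp only [innerSL_apply_apply] at h
  rw [radial, prim, ← h, ← intervalIntegral.integral_div]
  rfl

/-- Evaluation of `radial` at a point is a bounded functional and commutes with the Bochner
integral; the pointwise Duhamel formula then determines the vector-valued one. -/
theorem IsStrongSolution.isMild {a b : ℝ} {u : ℝ → E3 → ℂ} (hu : IsStrongSolution (Icc a b) u)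
    {w : ℝ → HalfL2} (hw : ∀ t ∈ Icc a b, ∀ x ∈ Omega, u t x = radial (w t) x) :
    IsMild (Icc a b) w := by
  have hc := hu.continuousOn hw
  refine ⟨hc, fun t₀ ht₀ t₁ ht₁ => eq_of_radial_eq fun x hx => ?_⟩
  have hsub : uIcc t₀ t₁ ⊆ Icc a b := uIcc_subset_Icc ht₀ ht₁
  have hF : IntervalIntegrable (fun t => prop (t₁ - t) (quintic (w t))) volume t₀ t₁ := by
    refine ContinuousOn.intervalIntegrable ?_
    have h1 : ContinuousOn (fun t => ((t₁ - t, quintic (w t)) : ℝ × HalfL2)) (uIcc t₀ t₁) :=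
      (by fun_prop : ContinuousOn (fun t => t₁ - t) (uIcc t₀ t₁)).prodMk
        (continuous_quintic.comp_continuousOn (hc.mono hsub))
    exact (continuous_prop.comp_continuousOn h1).congr fun t _ => rfl
  have e : ∫ t in t₀..t₁, freeProp (t₁ - t) (nonlin (u t)) x =
      ∫ t in t₀..t₁, radial (prop (t₁ - t) (quintic (w t))) x :=
    intervalIntegral.integral_congr fun t ht =>
      freeProp_eq_radial (nonlin_radial (hw t (hsub ht))) _ hx
  rw [← hw t₁ ht₁ x hx, hu.duhamel t₀ ht₀ t₁ ht₁ x hx, freeProp_eq_radial (hw t₀ ht₀) _ hx, e,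
    radial_sub, radial_smul, radial_intervalIntegral hF]

theorem energy_bound {f : E3 → ℂ} : ∫ x in Omega, ‖grad f x‖ ^ 2 ≤ 2 * energy f := by
  have : 0 ≤ ∫ x in Omega, ‖f x‖ ^ 6 := integral_nonneg fun x => by positivity
  rw [energy]
  linarith

/-- On `Ω` one has `1 + |x| ≤ 2|x|`, and `(1 + |x|)⁻⁵` is integrable because `5 > 3`. -/
theorem lintegral_norm_rpow_lt_top :
    ∫⁻ x in Omega, ENNReal.ofReal (‖x‖ ^ (-5 : ℝ)) < ⊤ := by
  have h : Integrable (fun x : E3 => (1 + ‖x‖) ^ (-5 : ℝ)) :=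
    integrable_one_add_norm (by simp; norm_num)
  have h2 := ((h.const_mul (2 ^ (5 : ℝ))).integrableOn (s := Omega)).lintegral_lt_top
  refine lt_of_le_of_lt (setLIntegral_mono' measurableSet_Omega fun x hx => ?_) h2
  have hx1 : 1 < ‖x‖ := hx
  refine ENNReal.ofReal_le_ofReal ?_
  rw [Real.rpow_neg (by positivity), Real.rpow_neg (by positivity), ← div_eq_mul_inv,
    ← Real.div_rpow (by positivity) (by positivity), ← Real.inv_rpow (by positivity)]
  refine Real.rpow_le_rpow (by positivity) ?_ (by norm_num)
  rw [inv_eq_one_div, div_le_div_iff₀ (by positivity) (by positivity)]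
  linarith

theorem normL10_pow_le {M a b : ℝ} {u : ℝ → E3 → ℂ}
    (h : ∀ t ∈ Icc a b, ∀ x ∈ Omega, ‖u t x‖ ^ 2 ≤ M * ‖x‖⁻¹) :
    normL10 (Icc a b) u ^ (10 : ℝ) ≤ ENNReal.ofReal (M ^ 5 *
      (∫⁻ x in Omega, ENNReal.ofReal (‖x‖ ^ (-5 : ℝ))).toReal * (b - a)) := by
  set κ := ∫⁻ x in Omega, ENNReal.ofReal (‖x‖ ^ (-5 : ℝ)) with hκ
  have hκt : κ ≠ ⊤ := lintegral_norm_rpow_lt_top.ne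
  rw [normL10, eLpNorm_eq_lintegral_rpow_enorm_toReal (by norm_num) (by norm_num),
    ENNReal.toReal_ofNat, ← ENNReal.rpow_mul, one_div, inv_mul_cancel₀ (by norm_num),
    ENNReal.rpow_one]
  have hpt : ∀ᵐ p ∂((volume : Measure ℝ).restrict (Icc a b)).prod volOmega,
      ‖u p.1 p.2‖ₑ ^ (10 : ℝ) ≤ ENNReal.ofReal (M ^ 5) * ENNReal.ofReal (‖p.2‖ ^ (-5 : ℝ)) := by
    rw [volOmega, Measure.prod_restrict]
    filter_upwards [ae_restrict_mem (measurableSet_Icc.prod measurableSet_Omega)] with p hp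
    have hx : 1 < ‖p.2‖ := hp.2
    have hle := h p.1 hp.1 p.2 hp.2
    have hM : 0 ≤ M := by
      by_contra hneg
      have : M * ‖p.2‖⁻¹ < 0 := mul_neg_of_neg_of_pos (not_le.1 hneg) (by positivity)
      linarith [sq_nonneg ‖u p.1 p.2‖]
    rw [← ofReal_norm, ENNReal.ofReal_rpow_of_nonneg (norm_nonneg _) (by norm_num),
      ← ENNReal.ofReal_mul (by positivity)]
    refine ENNReal.ofReal_le_ofReal ?_
    rw [show (10 : ℝ) = ((10 : ℕ) : ℝ) by norm_num, Real.rpow_natCast,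
      show (-5 : ℝ) = -((5 : ℕ) : ℝ) by norm_num, Real.rpow_neg (norm_nonneg _), Real.rpow_natCast,
      ← inv_pow, ← mul_pow]
    calc ‖u p.1 p.2‖ ^ 10 = (‖u p.1 p.2‖ ^ 2) ^ 5 := by ring
      _ ≤ _ := pow_le_pow_left₀ (by positivity) hle 5
  refine (lintegral_mono_ae hpt).trans ?_
  have : SFinite volOmega := by unfold volOmega; infer_instance
  rw [lintegral_prod _ (by fun_prop)]
  simp only
  rw [lintegral_const, lintegral_const_mul _ (by fun_prop), Measure.restrict_apply_univ,
    Real.volume_Icc]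
  change ENNReal.ofReal (M ^ 5) * κ * ENNReal.ofReal (b - a) ≤ _
  rcases le_or_gt M 0 with hM | hM
  · have : M ^ 5 ≤ 0 := by
      have := pow_nonneg (neg_nonneg.2 hM) 5
      nlinarith
    rw [ENNReal.ofReal_of_nonpos this]
    simp
  · rw [ENNReal.ofReal_mul (by positivity), ENNReal.ofReal_mul (by positivity),
      ENNReal.ofReal_toReal hκt]

end Solutions

end

end ExteriorNLS

/-! ### The lower bound for the interval length. -/

open ExteriorNLS
theorem lemma3p4 (E η₀ : ℝ) (hη₀ : 0 < η₀) :
    ∃ η₁ : ℝ, 0 < η₁ ∧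
      ∀ (tm tp : ℝ) (u : ℝ → E3 → ℂ), IsStrongSolution (Icc tm tp) u →
        ∀ t₀ ∈ Icc tm tp, energy (u t₀) ≤ E →
          ∀ a b : ℝ, tm ≤ a → a ≤ b → b ≤ tp →
            CarriesNorm η₀ (Icc a b) u →
            Unexceptional η₀ tm tp (Icc a b) u →
              η₁ < b - a := by
  set κ := (∫⁻ x in Omega, ENNReal.ofReal (‖x‖ ^ (-5 : ℝ))).toReal with hκ
  -- `B` bounds `‖w t₀‖²` through the energy, and `M = B + 2B³` bounds `‖w t‖²` at all times by
  -- conservation. The absolute value keeps `B` nonnegative for every real `E`.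
  set B := 2 * |E| / sphereArea with hB
  have hB0 : 0 ≤ B := div_nonneg (by positivity) sphereArea_pos.le
  set M := B + 2 * B ^ 3 with hM
  have hM0 : 0 ≤ M := by positivity
  have hκ0 : 0 ≤ κ := ENNReal.toReal_nonneg
  -- The summand `1` keeps the denominator positive even when `M ^ 5 * κ` vanishes.
  refine ⟨η₀ ^ 10 / (M ^ 5 * κ + 1), by positivity, ?_⟩
  intro tm tp u hu t₀ ht₀ hE a b hma hab hbp hcar _
  -- The representative is set to `0` outside `[tm, tp]`, so that `choose` yields a function of all
  -- times.
  have hex : ∀ t, ∃ w : HalfL2, t ∈ Icc tm tp → (∀ x ∈ Omega, u t x = radial w x) ∧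
      sphereArea * ‖w‖ ^ 2 ≤ ∫ x in Omega, ‖grad (u t) x‖ ^ 2 := fun t => by
    by_cases ht : t ∈ Icc tm tp
    · obtain ⟨w, hw⟩ := (hu.mem t ht).exists_radial
      exact ⟨w, fun _ => hw⟩
    · exact ⟨0, fun h => absurd h ht⟩
  choose w hw using hex
  have hmild := hu.isMild fun t ht => (hw t ht).1
  have h0 : ‖w t₀‖ ^ 2 ≤ B := by
    rw [hB, le_div_iff₀ sphereArea_pos, mul_comm]
    have := (hw t₀ ht₀).2.trans energy_bound
    linarith [le_abs_self E]
  have hnorm : ∀ t ∈ Icc tm tp, ‖w t‖ ^ 2 ≤ M := fun t ht => by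
    refine (hmild.norm_sq_le ht₀ ht).trans ?_
    have : ‖w t₀‖ ^ 6 = (‖w t₀‖ ^ 2) ^ 3 := by ring
    rw [this, hM]
    gcongr
  have hpt : ∀ t ∈ Icc a b, ∀ x ∈ Omega, ‖u t x‖ ^ 2 ≤ M * ‖x‖⁻¹ := fun t ht x hx => by
    have htI : t ∈ Icc tm tp := ⟨hma.trans ht.1, ht.2.trans hbp⟩
    have hx1 : 1 < ‖x‖ := hx
    rw [(hw t htI).1 x hx]
    have h1 := pow_le_pow_left₀ (norm_nonneg _) (norm_radial_le (w t) hx) 2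
    have h2 : (‖x‖ ^ (-(1 / 2) : ℝ)) ^ 2 = ‖x‖⁻¹ := by
      rw [← Real.rpow_natCast, ← Real.rpow_mul (norm_nonneg _), ← Real.rpow_neg_one]
      norm_num
    rw [mul_pow, h2] at h1
    exact h1.trans (mul_le_mul_of_nonneg_right (hnorm t htI) (by positivity))
  have hle := normL10_pow_le hpt
  have hlt : ENNReal.ofReal (η₀ ^ 10) < ENNReal.ofReal (M ^ 5 * κ * (b - a)) := by
    refine lt_of_lt_of_le ?_ hle
    have := ENNReal.rpow_lt_rpow hcar.1 (by norm_num : (0 : ℝ) < 10)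
    rwa [ENNReal.ofReal_rpow_of_pos hη₀, show (10 : ℝ) = ((10 : ℕ) : ℝ) by norm_num,
      Real.rpow_natCast] at this
  rw [ENNReal.ofReal_lt_ofReal_iff_of_nonneg (by positivity)] at hlt
  rw [div_lt_iff₀ (by positivity)]
  nlinarith
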